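/- Let $k$ be an algebraically closed field of characteristic $0$, and let $\mathcal D$ (the double of the Jordan plane) be the associative unital $k$-algebra with generators $u, v, \zeta, g^{\pm 1}, x, y$ and relations $$g g^{-1} = g^{-1} g = 1,\quad \zeta g = g\zeta,\quad gx = xg,\quad gy = yg + xg,\quad \zeta y = y\zeta + y,\quad \zeta x = x\zeta + x,$$ $$ug = gu,\quad vg = gv + gu,\quad v\zeta = \zeta v + v,\quad u\zeta = \zeta u + u,\quad yx = xy - \tfrac12 x^2,\quad vu = uv - \tfrac12 u^2,$$ $$ux = xu,\quad vx = xv + (1-g) + xu,\quad uy = yu + (1-g),\quad vy = yv - g\zeta + yu.$$ Put $q = ux + 2(1+g)$, $z = q^2 g^{-1}$ and $s = xv + uy + (-\tfrac12 ux + g - 1)\zeta - 2(1+g)$. Then $q$ is normal in $\mathcal D$, that is, $\mathcal D q = q\mathcal D$. Let $\mathcal D'$ be the Ore localization of $\mathcal D$ at the multiplicative set generated by $x$ and $q$, and put $z' = q^{-1}s \in \mathcal D'$. For a commutative ring $R$, let $A_2(R)$ be the Weyl algebra, i.e. the $R$-algebra generated by $q_1, q_2, p_1, p_2$ with relations $p_i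 q_i - q_i p_i = 1$ for $i = 1, 2$, all other pairs of generators commuting, and let $A_2'(R)$ be its localization at the multiplicative set generated by $q_1$ and $q_2$. Then $z$ is invertible in $\mathcal D'$ with inverse $g q^{-2}$; moreover $z' = q^{-1}s = s q^{-1}$, and $z'$ is central in $\mathcal D'$. The center of $\mathcal D'$ is the subalgebra $S = k[z^{\pm 1}, z']$ generated by $z, z^{-1}, z'$, where $z$ and $z'$ are algebraically independent over $k$ (so $S$ is the ring of polynomials in $z'$ over the Laurent polynomial ring in $z$). There is an isomorphism of $k$-algebras $\mathcal D' \cong A_2'(S)$ that restricts to the identity on $S$. -/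

import Mathlib

open Polynomial

/-! ## Localization at locally ad-nilpotent elements -/

/-- `s` is locally ad-nilpotent: for every `a`, iterating `a ↦ s a - a s` gives `0`. -/
def IsLocallyAdNilpotent {A : Type*} [Ring A] (s : A) : Prop :=
  ∀ a : A, ∃ n : ℕ, (fun b : A => s * b - b * s)^[n] a = 0

theorem iterate_ad_zero {A : Type*} [Ring A] (s : A) (n : ℕ) :
    (fun b : A => s * b - b * s)^[n] 0 = 0 :=
  Function.iterate_fixed (by simp) n

theorem iterate_ad_mono {A : Type*} [Ring A] (s : A) {m n : ℕ} (h : m ≤ n) {a : A}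
    (ha : (fun b : A => s * b - b * s)^[m] a = 0) :
    (fun b : A => s * b - b * s)^[n] a = 0 := by
  obtain ⟨j, rfl⟩ := Nat.exists_eq_add_of_le' h
  rw [Function.iterate_add_apply, ha, iterate_ad_zero]

theorem iterate_ad_add {A : Type*} [Ring A] (s : A) (n : ℕ) (a b : A) :
    (fun b : A => s * b - b * s)^[n] (a + b) =
      (fun b : A => s * b - b * s)^[n] a + (fun b : A => s * b - b * s)^[n] b := by
  induction n generalizing a b with
  | zero => rfl
  | succ n ih =>
    simp only [Function.iterate_succ_apply]
    rw [← ih]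
    congr 1
    noncomm_ring

theorem iterate_ad_mul {A : Type*} [Ring A] (s : A) (N : ℕ) : ∀ (m n : ℕ) (a b : A), m + n = N →
    (fun b : A => s * b - b * s)^[m] a = 0 → (fun b : A => s * b - b * s)^[n] b = 0 →
    (fun b : A => s * b - b * s)^[N] (a * b) = 0 := by
  induction N with
  | zero =>
    intro m n a b h ha _
    obtain rfl : m = 0 := by omega
    have ha' : a = 0 := ha
    simp [ha']
  | succ N ih =>
    intro m n a b h ha hb
    rcases m with _ | m
    · have ha' : a = 0 := ha
      rw [ha', zero_mul, iterate_ad_zero]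
    rcases n with _ | n
    · have hb' : b = 0 := hb
      rw [hb', mul_zero, iterate_ad_zero]
    rw [Function.iterate_succ_apply]
    have key : s * (a * b) - a * b * s = (s * a - a * s) * b + a * (s * b - b * s) := by
      noncomm_ring
    rw [key, iterate_ad_add, ih m (n + 1) _ _ (by omega) ha hb,
      ih (m + 1) n _ _ (by omega) ha hb, add_zero]

theorem exists_pow_mul_of_iterate_ad {A : Type*} [Ring A] (s : A) (n : ℕ) :
    ∀ a : A, (fun b : A => s * b - b * s)^[n] a = 0 → ∃ r, s ^ n * a = r * s := by
  induction n with
  | zero =>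
    intro a ha
    have ha' : a = 0 := ha
    exact ⟨0, by simp [ha']⟩
  | succ n ih =>
    intro a ha
    obtain ⟨r, hr⟩ := ih (s * a - a * s) ha
    refine ⟨s ^ n * a + r, ?_⟩
    rw [add_mul, ← hr, pow_succ]
    noncomm_ring

theorem pow_mul_eq_zero_of_iterate_ad {A : Type*} [Ring A] (s : A) (n : ℕ) :
    ∀ a : A, (fun b : A => s * b - b * s)^[n] a = 0 → a * s = 0 → s ^ n * a = 0 := by
  induction n with
  | zero =>
    intro a ha _
    have ha' : a = 0 := ha
    simp [ha']
  | succ n ih =>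
    intro a ha h0
    have h1 := ih (s * a - a * s) ha (by rw [h0, sub_zero, mul_assoc, h0, mul_zero])
    rwa [h0, sub_zero, ← mul_assoc, ← pow_succ] at h1

/-- A multiplicative set generated by locally ad-nilpotent elements satisfies the Ore
condition. -/
theorem nonempty_oreSet_closure {A : Type*} [Ring A] (T : Set A)
    (hT : ∀ s ∈ T, IsLocallyAdNilpotent s) :
    Nonempty (OreLocalization.OreSet (Submonoid.closure T)) := by
  have key : ∀ s ∈ Submonoid.closure T,
      (∀ r : A, ∃ s' ∈ Submonoid.closure T, ∃ r' : A, s' * r = r' * s) ∧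
      (∀ r : A, r * s = 0 → ∃ s' ∈ Submonoid.closure T, s' * r = 0) := by
    intro s hs
    induction hs using Submonoid.closure_induction with
    | mem s hs =>
      refine ⟨fun r => ?_, fun r h0 => ?_⟩
      · obtain ⟨n, hn⟩ := hT s hs r
        exact ⟨s ^ n, pow_mem (Submonoid.subset_closure hs) n,
          exists_pow_mul_of_iterate_ad s n r hn⟩
      · obtain ⟨n, hn⟩ := hT s hs r
        exact ⟨s ^ n, pow_mem (Submonoid.subset_closure hs) n,
          pow_mul_eq_zero_of_iterate_ad s n r hn h0⟩
    | one => exact ⟨fun r => ⟨1, one_mem _, r, by simp⟩, fun r h => ⟨1, one_mem _, by simpa using h⟩⟩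
    | mul a b _ _ iha ihb =>
      refine ⟨fun r => ?_, fun r h0 => ?_⟩
      · obtain ⟨s₁, hs₁, r₁, h₁⟩ := ihb.1 r
        obtain ⟨s₂, hs₂, r₂, h₂⟩ := iha.1 r₁
        refine ⟨s₂ * s₁, mul_mem hs₂ hs₁, r₂, ?_⟩
        rw [mul_assoc, h₁, ← mul_assoc, h₂, mul_assoc]
      · obtain ⟨s₁, hs₁, h₁⟩ := ihb.2 (r * a) (by rw [mul_assoc, h0])
        obtain ⟨s₂, hs₂, h₂⟩ := iha.2 (s₁ * r) (by rw [mul_assoc, h₁])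
        exact ⟨s₂ * s₁, mul_mem hs₂ hs₁, by rw [mul_assoc, h₂]⟩
  choose! h1 h2 using key
  choose! d hd n hn using h1
  refine ⟨⟨fun r₁ r₂ s h => ?_, fun r s => n s r, fun r s => ⟨d s r, hd s s.2 r⟩,
    fun r s => hn s s.2 r⟩⟩
  obtain ⟨s', hs', h'⟩ := h2 s s.2 (r₁ - r₂) (by rw [sub_mul, h, sub_self])
  exact ⟨⟨s', hs'⟩, by rwa [mul_sub, sub_eq_zero] at h'⟩

theorem iterate_two_ad {A : Type*} [Ring A] {a b c : A} (h : a * b - b * a = c)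
    (hc : Commute a c) : (fun b : A => a * b - b * a)^[2] b = 0 := by
  simp only [Function.iterate_succ, Function.iterate_zero, Function.comp, id, h]
  rw [hc.eq, sub_self]

/-- In a quotient of a free algebra, local ad-nilpotency may be checked on the generators. -/
theorem isLocallyAdNilpotent_of_generators {R X A : Type*} [CommRing R] [Ring A] [Algebra R A]
    (π : FreeAlgebra R X →ₐ[R] A) (hπ : Function.Surjective π) (s : A)
    (h : ∀ i : X, ∃ n : ℕ, (fun b => s * b - b * s)^[n] (π (FreeAlgebra.ι R i)) = 0) :
    IsLocallyAdNilpotent s := by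
  intro a
  obtain ⟨f, rfl⟩ := hπ a
  induction f using FreeAlgebra.induction with
  | grade0 c =>
    refine ⟨1, ?_⟩
    simp only [AlgHom.commutes, Function.iterate_one]
    rw [Algebra.commutes, sub_self]
  | grade1 i => exact h i
  | mul a b iha ihb =>
    obtain ⟨m, hm⟩ := iha
    obtain ⟨n, hn⟩ := ihb
    exact ⟨m + n, by rw [map_mul]; exact iterate_ad_mul s _ m n _ _ rfl hm hn⟩
  | add a b iha ihb =>
    obtain ⟨m, hm⟩ := iha
    obtain ⟨n, hn⟩ := ihb
    refine ⟨m + n, ?_⟩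
    rw [map_add, iterate_ad_add, iterate_ad_mono s (Nat.le_add_right m n) hm,
      iterate_ad_mono s (Nat.le_add_left n m) hn, add_zero]

/-- `a` is a normal element of the ring `A`: `A a = a A`. -/
def IsNormalElement {A : Type*} [Ring A] (a : A) : Prop :=
  Set.range (fun b : A => b * a) = Set.range (fun b : A => a * b)

/-! ## The algebra `𝒟`, the double of the Jordan plane -/

namespace JordanDouble

/-- The generators `u, v, ζ, g, g⁻¹, x, y`. -/
inductive Gen : Type
  | u | v | zeta | g | ginv | x | y

section Presentation

variable (k : Type*) [Field k]

/-- A generator as an element of the free algebra. -/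
def free (i : Gen) : FreeAlgebra k Gen := FreeAlgebra.ι k i

/-- The defining relations of the double of the Jordan plane. -/
inductive Rel : FreeAlgebra k Gen → FreeAlgebra k Gen → Prop
  | g_ginv : Rel (free k .g * free k .ginv) 1
  | ginv_g : Rel (free k .ginv * free k .g) 1
  | zeta_g : Rel (free k .zeta * free k .g) (free k .g * free k .zeta)
  | g_x : Rel (free k .g * free k .x) (free k .x * free k .g)
  | g_y : Rel (free k .g * free k .y) (free k .y * free k .g + free k .x * free k .g)
  | zeta_y : Rel (free k .zeta * free k .y) (free k .y * free k .zeta + free k .y)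
  | zeta_x : Rel (free k .zeta * free k .x) (free k .x * free k .zeta + free k .x)
  | u_g : Rel (free k .u * free k .g) (free k .g * free k .u)
  | v_g : Rel (free k .v * free k .g) (free k .g * free k .v + free k .g * free k .u)
  | v_zeta : Rel (free k .v * free k .zeta) (free k .zeta * free k .v + free k .v)
  | u_zeta : Rel (free k .u * free k .zeta) (free k .zeta * free k .u + free k .u)
  | y_x : Rel (free k .y * free k .x)
      (free k .x * free k .y - (1 / 2 : k) • (free k .x) ^ 2)
  | v_u : Rel (free k .v * free k .u)
      (free k .u * free k .v - (1 / 2 : k) • (free k .u) ^ 2)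
  | u_x : Rel (free k .u * free k .x) (free k .x * free k .u)
  | v_x : Rel (free k .v * free k .x)
      (free k .x * free k .v + (1 - free k .g) + free k .x * free k .u)
  | u_y : Rel (free k .u * free k .y) (free k .y * free k .u + (1 - free k .g))
  | v_y : Rel (free k .v * free k .y)
      (free k .y * free k .v - free k .g * free k .zeta + free k .y * free k .u)

end Presentation

end JordanDouble

/-- The `k`-algebra `𝒟` presented by `u, v, ζ, g^{±1}, x, y` and the above relations. -/
def JordanDouble (k : Type*) [Field k] : Type _ := RingQuot (JordanDouble.Rel k)

namespace JordanDouble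

section Elements

variable (k : Type*) [Field k]

noncomputable instance : Ring (JordanDouble k) :=
  inferInstanceAs (Ring (RingQuot (Rel k)))

noncomputable instance : Algebra k (JordanDouble k) :=
  inferInstanceAs (Algebra k (RingQuot (Rel k)))

/-- The quotient map from the free algebra to `𝒟`. -/
noncomputable def mk : FreeAlgebra k Gen →ₐ[k] JordanDouble k :=
  RingQuot.mkAlgHom k (Rel k)

theorem mk_surjective : Function.Surjective (mk k) :=
  RingQuot.mkAlgHom_surjective k (Rel k)

/-- A generator as an element of `𝒟`. -/
noncomputable def gen (i : Gen) : JordanDouble k := mk k (free k i)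

/-- `q = u x + 2 (1 + g)`. -/
noncomputable def q : JordanDouble k := gen k .u * gen k .x + 2 * (1 + gen k .g)

/-- `z = q² g⁻¹`. -/
noncomputable def z : JordanDouble k := q k ^ 2 * gen k .ginv

/-- `s = x v + u y + (-½ u x + g - 1) ζ - 2 (1 + g)`. -/
noncomputable def s : JordanDouble k :=
  gen k .x * gen k .v + gen k .u * gen k .y
    + (-((1 / 2 : k) • (gen k .u * gen k .x)) + gen k .g - 1) * gen k .zeta
    - 2 * (1 + gen k .g)

theorem rel_eq {a b : FreeAlgebra k Gen} (h : Rel k a b) :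
    mk k a = mk k b :=
  RingQuot.mkAlgHom_rel k h

theorem commute_ginv {a : JordanDouble k} (h : Commute a (gen k .g)) :
    Commute a (gen k .ginv) := by
  have h1 : gen k .g * gen k .ginv = 1 := by
    simpa [gen] using rel_eq k Rel.g_ginv
  have h2 : gen k .ginv * gen k .g = 1 := by
    simpa [gen] using rel_eq k Rel.ginv_g
  let U : (JordanDouble k)ˣ := ⟨gen k .g, gen k .ginv, h1, h2⟩
  exact Commute.units_inv_right (u := U) h

theorem x_isLocallyAdNilpotent : IsLocallyAdNilpotent (gen k .x) := by
  have gx : gen k .g * gen k .x = gen k .x * gen k .g := by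
    simpa [gen] using rel_eq k Rel.g_x
  have ux : gen k .u * gen k .x = gen k .x * gen k .u := by
    simpa [gen] using rel_eq k Rel.u_x
  have zx : gen k .zeta * gen k .x = gen k .x * gen k .zeta + gen k .x := by
    simpa [gen] using rel_eq k Rel.zeta_x
  have yx : gen k .y * gen k .x = gen k .x * gen k .y - (1 / 2 : k) • gen k .x ^ 2 := by
    simpa [gen] using rel_eq k Rel.y_x
  have vx : gen k .v * gen k .x
      = gen k .x * gen k .v + (1 - gen k .g) + gen k .x * gen k .u := by
    simpa [gen] using rel_eq k Rel.v_x
  apply isLocallyAdNilpotent_of_generators (mk k) (mk_surjective k)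
  intro i
  change ∃ n : ℕ, (fun b => gen k .x * b - b * gen k .x)^[n] (gen k i) = 0
  cases i with
  | u => exact ⟨1, by simp [ux]⟩
  | g => exact ⟨1, by simp [gx]⟩
  | ginv => exact ⟨1, by simp [(commute_ginv k (a := gen k .x) gx.symm).eq]⟩
  | x => exact ⟨1, by simp⟩
  | zeta =>
    have h : gen k .x * gen k .zeta - gen k .zeta * gen k .x = -gen k .x := by rw [zx]; abel
    exact ⟨2, iterate_two_ad h (Commute.refl _).neg_right⟩
  | y =>
    refine ⟨2, ?_⟩
    simp only [Function.iterate_succ, Function.iterate_zero, Function.comp, id, yx]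
    simp [pow_succ, mul_assoc]
  | v =>
    refine ⟨2, ?_⟩
    have h : gen k .x * gen k .v - gen k .v * gen k .x
        = gen k .g - 1 - gen k .x * gen k .u := by rw [vx]; abel
    simp only [Function.iterate_succ, Function.iterate_zero, Function.comp, id, h]
    simp only [mul_sub, sub_mul, gx, mul_assoc, ux]
    simp

theorem q_commute_u : Commute (q k) (gen k .u) := by
  have gu : Commute (gen k .g) (gen k .u) := by
    have : gen k .u * gen k .g = gen k .g * gen k .u := by
      simpa [gen] using rel_eq k Rel.u_g
    exact this.symm
  have xu : Commute (gen k .x) (gen k .u) := by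
    have : gen k .u * gen k .x = gen k .x * gen k .u := by
      simpa [gen] using rel_eq k Rel.u_x
    exact this.symm
  exact ((Commute.refl _).mul_left xu).add_left
    ((Commute.ofNat_left 2 _).mul_left ((Commute.one_left _).add_left gu))

theorem q_commute_x : Commute (q k) (gen k .x) := by
  have gx : Commute (gen k .g) (gen k .x) := by
    have : gen k .g * gen k .x = gen k .x * gen k .g := by
      simpa [gen] using rel_eq k Rel.g_x
    exact this
  have ux : Commute (gen k .u) (gen k .x) := by
    have : gen k .u * gen k .x = gen k .x * gen k .u := by
      simpa [gen] using rel_eq k Rel.u_x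
    exact this
  exact (ux.mul_left (Commute.refl _)).add_left
    ((Commute.ofNat_left 2 _).mul_left ((Commute.one_left _).add_left gx))

theorem q_commute_g : Commute (q k) (gen k .g) := by
  have xg : Commute (gen k .x) (gen k .g) := by
    have : gen k .g * gen k .x = gen k .x * gen k .g := by
      simpa [gen] using rel_eq k Rel.g_x
    exact this.symm
  have ug : Commute (gen k .u) (gen k .g) := by
    have : gen k .u * gen k .g = gen k .g * gen k .u := by
      simpa [gen] using rel_eq k Rel.u_g
    exact this
  exact (ug.mul_left xg).add_left
    ((Commute.ofNat_left 2 _).mul_left ((Commute.one_left _).add_left (Commute.refl _)))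

theorem q_commute_zeta : Commute (q k) (gen k .zeta) := by
  have zg : gen k .zeta * gen k .g = gen k .g * gen k .zeta := by
    simpa [gen] using rel_eq k Rel.zeta_g
  have uz : gen k .u * gen k .zeta = gen k .zeta * gen k .u + gen k .u := by
    simpa [gen] using rel_eq k Rel.u_zeta
  have zx : gen k .zeta * gen k .x = gen k .x * gen k .zeta + gen k .x := by
    simpa [gen] using rel_eq k Rel.zeta_x
  have hux : Commute (gen k .u * gen k .x) (gen k .zeta) := by
    have h1 : gen k .x * gen k .zeta = gen k .zeta * gen k .x - gen k .x := by
      rw [zx]; abel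
    change gen k .u * gen k .x * gen k .zeta = gen k .zeta * (gen k .u * gen k .x)
    rw [mul_assoc, h1, mul_sub, ← mul_assoc, uz]
    noncomm_ring
  have hg : Commute (gen k .g) (gen k .zeta) := zg.symm
  exact hux.add_left ((Commute.ofNat_left 2 _).mul_left ((Commute.one_left _).add_left hg))

theorem q_isLocallyAdNilpotent : IsLocallyAdNilpotent (q k) := by
  have gy : gen k .g * gen k .y = gen k .y * gen k .g + gen k .x * gen k .g := by
    simpa [gen] using rel_eq k Rel.g_y
  have yx : gen k .y * gen k .x = gen k .x * gen k .y - (1 / 2 : k) • gen k .x ^ 2 := by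
    simpa [gen] using rel_eq k Rel.y_x
  have uy : gen k .u * gen k .y = gen k .y * gen k .u + (1 - gen k .g) := by
    simpa [gen] using rel_eq k Rel.u_y
  have vu : gen k .v * gen k .u = gen k .u * gen k .v - (1 / 2 : k) • gen k .u ^ 2 := by
    simpa [gen] using rel_eq k Rel.v_u
  have vx : gen k .v * gen k .x
      = gen k .x * gen k .v + (1 - gen k .g) + gen k .x * gen k .u := by
    simpa [gen] using rel_eq k Rel.v_x
  have vg : gen k .v * gen k .g = gen k .g * gen k .v + gen k .g * gen k .u := by
    simpa [gen] using rel_eq k Rel.v_g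
  have cu := q_commute_u k
  have cx := q_commute_x k
  have cg := q_commute_g k
  have c1 : Commute (q k) 1 := Commute.one_right _
  have c2 : Commute (q k) 2 := Commute.ofNat_right _ 2
  apply isLocallyAdNilpotent_of_generators (mk k) (mk_surjective k)
  intro i
  change ∃ n : ℕ, (fun b => q k * b - b * q k)^[n] (gen k i) = 0
  cases i with
  | u => exact ⟨1, by simp [cu.eq]⟩
  | g => exact ⟨1, by simp [cg.eq]⟩
  | ginv => exact ⟨1, by simp [(commute_ginv k cg).eq]⟩
  | x => exact ⟨1, by simp [cx.eq]⟩
  | zeta => exact ⟨1, by simp [(q_commute_zeta k).eq]⟩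
  | y =>
    have h : q k * gen k .y - gen k .y * q k
        = (1 - gen k .g) * gen k .x + (1 / 2 : k) • (gen k .u * gen k .x ^ 2)
          + 2 * (gen k .x * gen k .g) := by
      have xy : gen k .x * gen k .y
          = gen k .y * gen k .x + (1 / 2 : k) • gen k .x ^ 2 := by
        rw [yx]; abel
      have e : q k * gen k .y = gen k .u * (gen k .x * gen k .y) + 2 * gen k .y
          + 2 * (gen k .g * gen k .y) := by
        rw [q]; noncomm_ring
      rw [e, xy, gy, mul_add (gen k .u), ← mul_assoc (gen k .u), uy, mul_smul_comm, q]
      noncomm_ring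
    exact ⟨2, iterate_two_ad h (((((c1.sub_right cg).mul_right cx)).add_right
      ((cu.mul_right (cx.pow_right 2)).smul_right _)).add_right
      (c2.mul_right (cx.mul_right cg)))⟩
  | v =>
    have h : q k * gen k .v - gen k .v * q k
        = (1 / 2 : k) • (gen k .u ^ 2 * gen k .x) - gen k .u * (1 - gen k .g)
          - gen k .u * gen k .x * gen k .u - 2 * (gen k .g * gen k .u) := by
      have e : gen k .v * q k = gen k .v * gen k .u * gen k .x + 2 * gen k .v
          + 2 * (gen k .v * gen k .g) := by
        rw [q]; noncomm_ring
      rw [e, vu, vg, sub_mul, mul_assoc (gen k .u) (gen k .v), vx, smul_mul_assoc, q]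
      noncomm_ring
    exact ⟨2, iterate_two_ad h (((((cu.pow_right 2).mul_right cx).smul_right _).sub_right
      (cu.mul_right (c1.sub_right cg))).sub_right ((cu.mul_right cx).mul_right cu)
      |>.sub_right (c2.mul_right (cg.mul_right cu)))⟩

/-- The multiplicative set generated by `x` and `q`. -/
noncomputable abbrev denominators : Submonoid (JordanDouble k) := Submonoid.closure {gen k .x, q k}

noncomputable instance : OreLocalization.OreSet (denominators k) :=
  (nonempty_oreSet_closure _ (by
    rintro s (rfl | rfl)
    · exact x_isLocallyAdNilpotent k
    · exact q_isLocallyAdNilpotent k)).some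

end Elements

end JordanDouble

/-- The Ore localization `𝒟′` of `𝒟` at the multiplicative set generated by `x` and `q`. -/
noncomputable abbrev JordanDoubleLoc (k : Type*) [Field k] : Type _ :=
  OreLocalization (JordanDouble.denominators k) (JordanDouble k)

namespace JordanDoubleLoc

section Elements

variable (k : Type*) [Field k]

/-- The canonical map `𝒟 → 𝒟′`. -/
noncomputable def ofD : JordanDouble k →+* JordanDoubleLoc k := OreLocalization.numeratorRingHom

/-- The inverse of `q` in `𝒟′`. -/
noncomputable def qInv : JordanDoubleLoc k :=
  OreLocalization.oreDiv 1
    (⟨JordanDouble.q k, Submonoid.subset_closure (by simp)⟩ : JordanDouble.denominators k)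

/-- `z = q² g⁻¹` in `𝒟′`. -/
noncomputable def z : JordanDoubleLoc k := ofD k (JordanDouble.z k)

/-- The inverse `g q⁻²` of `z` in `𝒟′`. -/
noncomputable def zInv : JordanDoubleLoc k := ofD k (JordanDouble.gen k .g) * qInv k ^ 2

/-- `z' = q⁻¹ [x v + u y + (-½ u x + g - 1) ζ - 2 (1 + g)]` in `𝒟′`. -/
noncomputable def zPrime : JordanDoubleLoc k := qInv k * ofD k (JordanDouble.s k)

end Elements

end JordanDoubleLoc

/-! ## Weyl algebras and their localizations -/

namespace WeylAlgebra

section Presentation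

variable (n : ℕ) (R : Type*) [CommRing R]

/-- The free generator `q_i`. -/
def freeQ (i : Fin n) : FreeAlgebra R (Fin n ⊕ Fin n) := FreeAlgebra.ι R (Sum.inl i)

/-- The free generator `p_i`. -/
def freeP (i : Fin n) : FreeAlgebra R (Fin n ⊕ Fin n) := FreeAlgebra.ι R (Sum.inr i)

/-- The defining relations of the `n`-th Weyl algebra: `p_i q_i - q_i p_i = 1`, and all other
pairs of generators commute. -/
inductive Rel : FreeAlgebra R (Fin n ⊕ Fin n) → FreeAlgebra R (Fin n ⊕ Fin n) → Prop
  | q_q (i j : Fin n) : Rel (freeQ n R i * freeQ n R j) (freeQ n R j * freeQ n R i)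
  | p_p (i j : Fin n) : Rel (freeP n R i * freeP n R j) (freeP n R j * freeP n R i)
  | p_q_self (i : Fin n) : Rel (freeP n R i * freeQ n R i) (freeQ n R i * freeP n R i + 1)
  | p_q (i j : Fin n) (h : i ≠ j) :
      Rel (freeP n R i * freeQ n R j) (freeQ n R j * freeP n R i)

end Presentation

end WeylAlgebra

/-- The Weyl algebra `A_n(R)`, generated over `R` by `q_1, …, q_n, p_1, …, p_n`. -/
def WeylAlgebra (n : ℕ) (R : Type*) [CommRing R] : Type _ := RingQuot (WeylAlgebra.Rel n R)

namespace WeylAlgebra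

section Elements

variable (n : ℕ) (R : Type*) [CommRing R]

noncomputable instance : Ring (WeylAlgebra n R) :=
  inferInstanceAs (Ring (RingQuot (Rel n R)))

noncomputable instance {A : Type*} [CommSemiring A] [Algebra A R] :
    Algebra A (WeylAlgebra n R) :=
  inferInstanceAs (Algebra A (RingQuot (Rel n R)))

/-- The quotient map from the free algebra to `A_n(R)`. -/
noncomputable def mk : FreeAlgebra R (Fin n ⊕ Fin n) →ₐ[R] WeylAlgebra n R :=
  RingQuot.mkAlgHom R (Rel n R)

theorem mk_surjective : Function.Surjective (mk n R) :=
  RingQuot.mkAlgHom_surjective R (Rel n R)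

theorem rel_eq {a b : FreeAlgebra R (Fin n ⊕ Fin n)} (h : Rel n R a b) :
    mk n R a = mk n R b :=
  RingQuot.mkAlgHom_rel R h

/-- The generator `q_i` of `A_n(R)`. -/
noncomputable def q (i : Fin n) : WeylAlgebra n R := mk n R (freeQ n R i)

/-- The generator `p_i` of `A_n(R)`. -/
noncomputable def p (i : Fin n) : WeylAlgebra n R := mk n R (freeP n R i)

theorem q_isLocallyAdNilpotent (i : Fin n) : IsLocallyAdNilpotent (q n R i) := by
  apply isLocallyAdNilpotent_of_generators (mk n R) (mk_surjective n R)
  rintro (j | j)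
  · change ∃ m : ℕ, (fun b => q n R i * b - b * q n R i)^[m] (q n R j) = 0
    have h : q n R i * q n R j = q n R j * q n R i := by
      simpa [q] using rel_eq n R (Rel.q_q i j)
    exact ⟨1, by simp [h]⟩
  · change ∃ m : ℕ, (fun b => q n R i * b - b * q n R i)^[m] (p n R j) = 0
    by_cases hij : j = i
    · subst hij
      have h : p n R j * q n R j = q n R j * p n R j + 1 := by
        simpa [p, q] using rel_eq n R (Rel.p_q_self j)
      have h' : q n R j * p n R j - p n R j * q n R j = -1 := by rw [h]; abel
      exact ⟨2, iterate_two_ad h' (Commute.one_right _).neg_right⟩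
    · have h : p n R j * q n R i = q n R i * p n R j := by
        simpa [p, q] using rel_eq n R (Rel.p_q j i hij)
      exact ⟨1, by simp [h]⟩

/-- The multiplicative set generated by `q_1, …, q_n`. -/
noncomputable abbrev denominators : Submonoid (WeylAlgebra n R) := Submonoid.closure (Set.range (q n R))

noncomputable instance : OreLocalization.OreSet (denominators n R) :=
  (nonempty_oreSet_closure _ (by
    rintro s ⟨i, rfl⟩
    exact q_isLocallyAdNilpotent n R i)).some

end Elements

end WeylAlgebra

/-- The localized Weyl algebra `A'_n(R)`, the Ore localization of `A_n(R)` at the multiplicative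
set generated by `q_1, …, q_n`. -/
noncomputable abbrev WeylAlgebraLoc (n : ℕ) (R : Type*) [CommRing R] : Type _ :=
  OreLocalization (WeylAlgebra.denominators n R) (WeylAlgebra n R)

/-! The algebra `𝒟′` consists of differential operators in two commuting coordinates x and q. Put θ
= -2x⁻¹y - ζ. The relations make ζ and θ the Euler operators x∂/∂x and q∂/∂q: they commute with each
other, [ζ, x] = x, [θ, q] = q and [ζ, q] = [θ, x] = 0. Hence p₁ = x⁻¹ζ and p₂ = q⁻¹θ complete x, q
to a Weyl system (`JordanDoubleLoc.isWeylSystem`). The rest of `𝒟` contributes central parameters.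
Conjugation by q is a square root of conjugation by g, so z = q²g⁻¹ is central; s is twisted by the
generators in the same way as q, so z' = q⁻¹s is central. Conversely g = z⁻¹q², and u, y, v are
recovered by solving the definitions of q, θ and s = qz'.

These formulas make sense in any ring carrying an `EulerSystem`, and there they satisfy the
relations of `𝒟` (`lift_genImage_eq_of_rel`, the main calculation). In A'_2(k[z^{±1}][z']) they give
`toWeyl`; the Weyl system in `𝒟′` gives `fromWeyl`. The two are inverse on generators, so no basis
of `𝒟` is needed.

For the center (`center_eq_of_isWeylSystem`), in characteristic 0 an element commuting with every
q_i has degree 0 in the p_i, and commuting with each q_i p_i then forces degree 0 in each q_i,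
leaving the scalars. The scalars embed because A'_n(R) acts on formal Laurent series over R
(`algebraMap_injective`); this is the algebraic independence of z and z'. -/

namespace JordanDouble

/-! ### Representations of `𝒟` by Euler operators. -/

variable {k : Type*} [Field k] {A : Type*} [Ring A] [Algebra k A]

/-- The universal property of the presentation of `𝒟`. -/
noncomputable def lift (f : Gen → A)
    (hf : ∀ ⦃a b⦄, Rel k a b → FreeAlgebra.lift k f a = FreeAlgebra.lift k f b) :
    JordanDouble k →ₐ[k] A :=
  RingQuot.liftAlgHom k ⟨FreeAlgebra.lift k f, hf⟩

theorem lift_gen (f : Gen → A)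
    (hf : ∀ ⦃a b⦄, Rel k a b → FreeAlgebra.lift k f a = FreeAlgebra.lift k f b) (i : Gen) :
    lift f hf (gen k i) = f i := by
  unfold lift gen mk
  erw [RingQuot.liftAlgHom_mkAlgHom_apply]
  simp [free]

theorem algHom_ext {φ ψ : JordanDouble k →ₐ[k] A} (h : ∀ i, φ (gen k i) = ψ (gen k i)) :
    φ = ψ := by
  have h' : φ.comp (mk k) = ψ.comp (mk k) := by
    ext i
    exact h i
  ext a
  obtain ⟨f, rfl⟩ := mk_surjective k a
  exact DFunLike.congr_fun h' f

/-- Elements of a ring from which a representation of `𝒟` can be built: `ζ` and `θ` act on the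
commuting elements `x` and `q` as the Euler operators `x ∂/∂x` and `q ∂/∂q`, the unit `g` is a
constant multiple of `q²`, and `w` is central. -/
structure EulerSystem (A : Type*) [Ring A] where
  /-- the coordinate `x` -/
  x : A
  /-- the inverse of `x` -/
  xi : A
  /-- the coordinate `q` -/
  q : A
  /-- the group-like element -/
  g : A
  /-- the inverse of `g` -/
  gi : A
  /-- the central parameter -/
  w : A
  /-- the Euler operator of `x` -/
  ζ : A
  /-- the Euler operator of `q` -/
  θ : A
  x_mul_xi : x * xi = 1
  xi_mul_x : xi * x = 1
  g_mul_gi : g * gi = 1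
  gi_mul_g : gi * g = 1
  commute_x_q : Commute x q
  commute_x_g : Commute x g
  commute_q_g : Commute q g
  commute_w : ∀ a, Commute a w
  ζ_mul_x : ζ * x = x * ζ + x
  ζ_mul_q : ζ * q = q * ζ
  ζ_mul_g : ζ * g = g * ζ
  θ_mul_x : θ * x = x * θ
  θ_mul_q : θ * q = q * θ + q
  θ_mul_g : θ * g = g * θ + 2 * g
  θ_mul_ζ : θ * ζ = ζ * θ

namespace EulerSystem

variable (k) (E : EulerSystem A)

theorem mul_xi {a : A} (h : Commute E.x a) : a * E.xi = E.xi * a :=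
  (Commute.units_inv_left (u := ⟨E.x, E.xi, E.x_mul_xi, E.xi_mul_x⟩) h).symm

theorem ζ_mul_xi : E.ζ * E.xi = E.xi * E.ζ - E.xi := by
  have h2 : ∀ a, E.xi * (E.x * a) = a := fun a => by rw [← mul_assoc, E.xi_mul_x, one_mul]
  calc E.ζ * E.xi = E.xi * (E.x * E.ζ) * E.xi := by rw [h2]
    _ = E.xi * (E.ζ * E.x - E.x) * E.xi := by rw [E.ζ_mul_x]; abel_nf
    _ = E.xi * E.ζ * (E.x * E.xi) - E.xi * E.x * E.xi := by noncomm_ring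
    _ = _ := by rw [E.x_mul_xi, E.xi_mul_x, mul_one, one_mul]

/-- The images of the generators of `𝒟` defined by an Euler system. -/
def genImage : Gen → A
  | .x => E.x
  | .g => E.g
  | .ginv => E.gi
  | .zeta => E.ζ
  -- The solution of q = ux + 2(1 + g) for u.
  | .u => E.xi * (E.q - 2 - 2 * E.g)
  -- The solution of θ = -2x⁻¹y - ζ for y.
  | .y => -((1 / 2 : k) • (E.x * (E.θ + E.ζ)))
  -- The solution of s = qw for v, after substituting u and y; the coefficient -½ux + g - 1 of ζ in
  -- s equals 2g - ½q.
  | .v => E.xi * (E.q * E.w + 2 + 2 * E.g + ((1 / 2 : k) • E.q - 1 - E.g) * (E.θ + E.ζ)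
      + ((1 / 2 : k) • E.q - 2 * E.g) * E.ζ)

variable [CharZero k]

/-- The commutation rules of an Euler system bring every word to the order x^{±1}, g, q, w, ζ, θ.
Once both sides of a relation are in this normal form, their equality is a linear identity over `k`.
-/
theorem lift_genImage_eq_of_rel ⦃a b : FreeAlgebra k Gen⦄ (h : Rel k a b) :
    FreeAlgebra.lift k (E.genImage k) a = FreeAlgebra.lift k (E.genImage k) b := by
  have h1 : ∀ a, E.x * (E.xi * a) = a := fun a => by rw [← mul_assoc, E.x_mul_xi, one_mul]
  have h2 : ∀ a, E.xi * (E.x * a) = a := fun a => by rw [← mul_assoc, E.xi_mul_x, one_mul]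
  have h3 := E.mul_xi E.commute_x_q
  have h4 := E.mul_xi E.commute_x_g
  have h5 := E.mul_xi (a := E.θ) E.θ_mul_x.symm
  have h6 := E.ζ_mul_xi
  -- Each rewriting rule is also needed in front of a further factor, since products are nested to
  -- the right.
  have e {a b c : A} (h : a * b = c) (d : A) : a * (b * d) = c * d := by rw [← h, mul_assoc]
  have hqx := E.commute_x_q.eq.symm
  have hgx := E.commute_x_g.eq.symm
  have hqg := E.commute_q_g.eq
  have hwx := (E.commute_w E.x).eq.symm
  have hwxi := (E.commute_w E.xi).eq.symm
  have hwq := (E.commute_w E.q).eq.symm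
  have hwg := (E.commute_w E.g).eq.symm
  have hwζ := (E.commute_w E.ζ).eq
  have hwθ := (E.commute_w E.θ).eq
  have h22 : (2 : A) = 1 + 1 := one_add_one_eq_two.symm
  cases h
  all_goals
    simp only [free, map_mul, map_add, map_sub, map_one, map_smul, FreeAlgebra.lift_ι_apply,
      genImage, E.g_mul_gi, E.gi_mul_g, E.ζ_mul_g, E.ζ_mul_x, hgx, pow_two]
  all_goals
    simp only [mul_add, add_mul, sub_mul, mul_sub, neg_mul, mul_neg, smul_mul_assoc, mul_smul_comm,
      smul_add, smul_sub, smul_neg, mul_assoc, one_mul, mul_one, h22,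
      E.x_mul_xi, E.xi_mul_x, h1, h2, h3, e h3, h4, e h4, h5, e h5, h6, e h6, hqx, e hqx, hgx,
      e hgx, hqg, e hqg, hwx, e hwx, hwxi, e hwxi, hwq, hwg, hwζ, hwθ, E.ζ_mul_x, e E.ζ_mul_x,
      E.ζ_mul_q, e E.ζ_mul_q, E.ζ_mul_g, e E.ζ_mul_g, E.θ_mul_x, e E.θ_mul_x, E.θ_mul_q,
      e E.θ_mul_q, E.θ_mul_g, e E.θ_mul_g, E.θ_mul_ζ]
  all_goals module

/-- The representation of `𝒟` defined by an Euler system. -/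
noncomputable def hom : JordanDouble k →ₐ[k] A :=
  lift (E.genImage k) (E.lift_genImage_eq_of_rel k)

theorem hom_gen (i : Gen) : E.hom k (gen k i) = E.genImage k i :=
  lift_gen _ _ i

theorem hom_q : E.hom k (JordanDouble.q k) = E.q := by
  have h1 : E.xi * (E.q - 2 - 2 * E.g) * E.x = E.q - 2 - 2 * E.g := by
    have : Commute E.x (E.q - 2 - 2 * E.g) :=
      (E.commute_x_q.sub_right (Commute.ofNat_right _ 2)).sub_right
        ((Commute.ofNat_right _ 2).mul_right E.commute_x_g)
    rw [mul_assoc, ← this.eq, ← mul_assoc, E.xi_mul_x, one_mul]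
  simp only [JordanDouble.q, map_add, map_mul, hom_gen, genImage, map_ofNat, h1, mul_add, mul_one]
  abel

/-- The image of v was chosen for this: every term of xv except qw cancels against the rest of s. -/
theorem hom_s : E.hom k (JordanDouble.s k) = E.q * E.w := by
  have hux : E.hom k (gen k .u) * E.hom k (gen k .x) = E.q - 2 - 2 * E.g := by
    rw [← map_mul, eq_sub_of_add_eq
      (show gen k .u * gen k .x + 2 * (1 + gen k .g) = JordanDouble.q k from rfl),
      map_sub, hom_q]
    simp only [map_add, map_mul, hom_gen, genImage, map_ofNat, mul_add, mul_one]
    abel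
  have huy : E.hom k (gen k .u) * E.hom k (gen k .y)
      = -((1 / 2 : k) • ((E.q - 2 - 2 * E.g) * (E.θ + E.ζ))) := by
    have hux' := hux
    simp only [hom_gen, genImage] at hux' ⊢
    rw [mul_neg, mul_smul_comm, ← mul_assoc, hux']
  have hxv : E.hom k (gen k .x) * E.hom k (gen k .v)
      = E.q * E.w + 2 + 2 * E.g + ((1 / 2 : k) • E.q - 1 - E.g) * (E.θ + E.ζ)
      + ((1 / 2 : k) • E.q - 2 * E.g) * E.ζ := by
    simp only [hom_gen, genImage]
    rw [← mul_assoc, E.x_mul_xi, one_mul]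
  have h22 : (2 : A) = 1 + 1 := one_add_one_eq_two.symm
  simp only [JordanDouble.s, map_add, map_sub, map_mul, map_neg, map_smul, map_one, map_ofNat,
    hux, huy, hxv]
  simp only [hom_gen, genImage, mul_add, add_mul, sub_mul, neg_mul, smul_mul_assoc, smul_sub,
    smul_add, one_mul, mul_one, h22]
  module

end EulerSystem
end JordanDouble

/-! ### Commutation of q, s and z with the generators of `𝒟`; normality of q. -/

namespace JordanDouble

section Relations

variable (k : Type*) [Field k]

theorem g_mul_ginv : gen k .g * gen k .ginv = 1 := by simpa [gen] using rel_eq k Rel.g_ginv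

theorem ginv_mul_g : gen k .ginv * gen k .g = 1 := by simpa [gen] using rel_eq k Rel.ginv_g

theorem zeta_mul_g : gen k .zeta * gen k .g = gen k .g * gen k .zeta := by
  simpa [gen] using rel_eq k Rel.zeta_g

theorem g_mul_x : gen k .g * gen k .x = gen k .x * gen k .g := by
  simpa [gen] using rel_eq k Rel.g_x

theorem g_mul_y : gen k .g * gen k .y = gen k .y * gen k .g + gen k .x * gen k .g := by
  simpa [gen] using rel_eq k Rel.g_y

theorem zeta_mul_y : gen k .zeta * gen k .y = gen k .y * gen k .zeta + gen k .y := by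
  simpa [gen] using rel_eq k Rel.zeta_y

theorem zeta_mul_x : gen k .zeta * gen k .x = gen k .x * gen k .zeta + gen k .x := by
  simpa [gen] using rel_eq k Rel.zeta_x

theorem g_mul_u : gen k .g * gen k .u = gen k .u * gen k .g := by
  simpa [gen] using (rel_eq k Rel.u_g).symm

theorem v_mul_g : gen k .v * gen k .g = gen k .g * gen k .v + gen k .g * gen k .u := by
  simpa [gen] using rel_eq k Rel.v_g

theorem zeta_mul_v : gen k .zeta * gen k .v = gen k .v * gen k .zeta - gen k .v :=
  eq_sub_of_add_eq (by simpa [gen] using (rel_eq k Rel.v_zeta).symm)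

theorem zeta_mul_u : gen k .zeta * gen k .u = gen k .u * gen k .zeta - gen k .u :=
  eq_sub_of_add_eq (by simpa [gen] using (rel_eq k Rel.u_zeta).symm)

theorem y_mul_x :
    gen k .y * gen k .x = gen k .x * gen k .y - (1 / 2 : k) • (gen k .x * gen k .x) := by
  simpa [gen, pow_two] using rel_eq k Rel.y_x

theorem v_mul_u :
    gen k .v * gen k .u = gen k .u * gen k .v - (1 / 2 : k) • (gen k .u * gen k .u) := by
  simpa [gen, pow_two] using rel_eq k Rel.v_u

theorem u_mul_x : gen k .u * gen k .x = gen k .x * gen k .u := by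
  simpa [gen] using rel_eq k Rel.u_x

theorem v_mul_x : gen k .v * gen k .x
    = gen k .x * gen k .v + (1 - gen k .g) + gen k .x * gen k .u := by
  simpa [gen] using rel_eq k Rel.v_x

theorem u_mul_y : gen k .u * gen k .y = gen k .y * gen k .u + (1 - gen k .g) := by
  simpa [gen] using rel_eq k Rel.u_y

theorem v_mul_y : gen k .v * gen k .y
    = gen k .y * gen k .v - gen k .g * gen k .zeta + gen k .y * gen k .u := by
  simpa [gen] using rel_eq k Rel.v_y

theorem mul_mul_of_mul_eq {A : Type*} [Semigroup A] {a b c : A} (h : a * b = c) (d : A) :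
    a * (b * d) = c * d := by
  rw [← h, mul_assoc]

theorem ginv_mul_g_mul (a : JordanDouble k) : gen k .ginv * (gen k .g * a) = a := by
  rw [← mul_assoc, ginv_mul_g, one_mul]

theorem ginv_mul_y : gen k .ginv * gen k .y = (gen k .y - gen k .x) * gen k .ginv := by
  have h : gen k .y = gen k .g * (gen k .y - gen k .x) * gen k .ginv := by
    rw [mul_sub, g_mul_y, g_mul_x, add_sub_cancel_right, mul_assoc, g_mul_ginv, mul_one]
  conv_lhs => rw [h, mul_assoc, ginv_mul_g_mul]

theorem ginv_mul_v : gen k .ginv * gen k .v = (gen k .v + gen k .u) * gen k .ginv := by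
  have h : gen k .v = gen k .g * (gen k .v + gen k .u) * gen k .ginv := by
    rw [mul_add, ← v_mul_g, mul_assoc, g_mul_ginv, mul_one]
  conv_lhs => rw [h, mul_assoc, ginv_mul_g_mul]

variable [CharZero k]

/-- Conjugation by q shifts y by ½x, whereas conjugation by g shifts it by x. With the analogous
shifts of v by -½u and -u, this is why q²g⁻¹ is central. -/
theorem q_mul_y :
    q k * gen k .y = (gen k .y + (1 / 2 : k) • gen k .x) * q k := by
  have e {a b c : JordanDouble k} := mul_mul_of_mul_eq (a := a) (b := b) (c := c)
  have h22 : (2 : JordanDouble k) = 1 + 1 := one_add_one_eq_two.symm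
  unfold q
  simp only [mul_add, add_mul, smul_mul_assoc, mul_assoc, one_mul, mul_one, h22,
    g_mul_y, e (y_mul_x k), sub_mul, mul_sub, u_mul_x, u_mul_y]
  module

theorem q_mul_v :
    q k * gen k .v = (gen k .v - (1 / 2 : k) • gen k .u) * q k := by
  have e {a b c : JordanDouble k} := mul_mul_of_mul_eq (a := a) (b := b) (c := c)
  have h22 : (2 : JordanDouble k) = 1 + 1 := one_add_one_eq_two.symm
  unfold q
  simp only [mul_add, add_mul, sub_mul, mul_sub, smul_mul_assoc, mul_smul_comm, mul_assoc,
    one_mul, mul_one, h22, g_mul_u, v_mul_g, v_mul_u, u_mul_x, e (u_mul_x k), e (v_mul_x k)]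
  module

/-- On x, g, u, ζ and y the element s has the same twisted commutation as q, so the twists cancel in
q⁻¹s. The generator v is left out: in `𝒟′` it can be expressed through s and the other generators.
-/
theorem s_commutation :
    Commute (s k) (gen k .x) ∧ Commute (s k) (gen k .g) ∧ Commute (s k) (gen k .u) ∧
      Commute (s k) (gen k .zeta) ∧
      s k * gen k .y = (gen k .y + (1 / 2 : k) • gen k .x) * s k := by
  have e {a b c : JordanDouble k} := mul_mul_of_mul_eq (a := a) (b := b) (c := c)
  have h22 : (2 : JordanDouble k) = 1 + 1 := one_add_one_eq_two.symm
  unfold Commute SemiconjBy s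
  refine ⟨?_, ?_, ?_, ?_, ?_⟩
  all_goals
    simp only [mul_add, add_mul, sub_mul, mul_sub, neg_mul, mul_neg, smul_mul_assoc, mul_smul_comm,
      smul_add, smul_sub, mul_assoc, one_mul, mul_one, h22,
      zeta_mul_g, e (zeta_mul_g k), g_mul_x, e (g_mul_x k), g_mul_y, e (g_mul_y k),
      zeta_mul_y, e (zeta_mul_y k), zeta_mul_x, e (zeta_mul_x k), g_mul_u, e (g_mul_u k),
      v_mul_g, zeta_mul_v, zeta_mul_u, e (zeta_mul_u k), e (y_mul_x k), v_mul_u,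
      u_mul_x, e (u_mul_x k), v_mul_x, u_mul_y, e (u_mul_y k), v_mul_y]
    module

theorem commute_s_q : Commute (s k) (q k) := by
  obtain ⟨hx, hg, hu, -, -⟩ := s_commutation k
  exact (hu.mul_right hx).add_right
    ((Commute.ofNat_right _ 2).mul_right ((Commute.one_right _).add_right hg))

theorem commute_z_gen (i : Gen) : Commute (z k) (gen k i) := by
  have of {a} (h : Commute (q k) a) (hg : Commute (gen k .ginv) a) : Commute (z k) a :=
    (h.pow_left 2).mul_left hg
  have hqi : Commute (q k) (gen k .ginv) := commute_ginv k (q_commute_g k)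
  cases i with
  | u => exact of (q_commute_u k) (commute_ginv k (g_mul_u k).symm).symm
  | g => exact of (q_commute_g k) ((ginv_mul_g k).trans (g_mul_ginv k).symm)
  | ginv => exact of hqi (Commute.refl _)
  | x => exact of (q_commute_x k) (commute_ginv k (g_mul_x k).symm).symm
  | zeta => exact of (q_commute_zeta k) (commute_ginv k (zeta_mul_g k)).symm
  | y =>
    -- Passing g⁻¹ turns y into y - x, and each of the two factors q restores ½x.
    have h1 : q k * (gen k .y - gen k .x) = (gen k .y - (1 / 2 : k) • gen k .x) * q k := by
      rw [mul_sub, q_mul_y, (q_commute_x k).eq, ← sub_mul]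
      congr 1
      module
    have h2 : q k * (gen k .y - (1 / 2 : k) • gen k .x) = gen k .y * q k := by
      rw [mul_sub, q_mul_y, mul_smul_comm, (q_commute_x k).eq, ← smul_mul_assoc, ← sub_mul,
        add_sub_cancel_right]
    unfold Commute SemiconjBy z
    rw [mul_assoc, ginv_mul_y, pow_two, mul_assoc, ← mul_assoc (q k) (_ - _), h1,
      ← mul_assoc, ← mul_assoc, h2]
    simp only [mul_assoc]
  | v =>
    have h1 : q k * (gen k .v + gen k .u) = (gen k .v + (1 / 2 : k) • gen k .u) * q k := by
      rw [mul_add, q_mul_v, (q_commute_u k).eq, ← add_mul]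
      congr 1
      module
    have h2 : q k * (gen k .v + (1 / 2 : k) • gen k .u) = gen k .v * q k := by
      rw [mul_add, q_mul_v, mul_smul_comm, (q_commute_u k).eq, ← smul_mul_assoc, ← add_mul,
        sub_add_cancel]
    unfold Commute SemiconjBy z
    rw [mul_assoc, ginv_mul_v, pow_two, mul_assoc, ← mul_assoc (q k) (_ + _), h1,
      ← mul_assoc, ← mul_assoc, h2]
    simp only [mul_assoc]

end Relations

section Generators

variable {k : Type*} [Field k]

/-- Induction on the generators of `𝒟`. -/
theorem gen_induction {P : JordanDouble k → Prop} (algebraMap : ∀ c, P (algebraMap k _ c))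
    (gen : ∀ i, P (gen k i)) (mul : ∀ a b, P a → P b → P (a * b))
    (add : ∀ a b, P a → P b → P (a + b)) (a : JordanDouble k) : P a := by
  obtain ⟨f, rfl⟩ := mk_surjective k a
  induction f using FreeAlgebra.induction with
  | grade0 c => rw [AlgHom.commutes]; exact algebraMap c
  | grade1 i => exact gen i
  | mul a b iha ihb => rw [map_mul]; exact mul _ _ iha ihb
  | add a b iha ihb => rw [map_add]; exact add _ _ iha ihb

theorem commute_of_commute_gen {A : Type*} [Ring A] [Algebra k A] (φ : JordanDouble k →ₐ[k] A)
    {c : A} (h : ∀ i, Commute c (φ (gen k i))) (a : JordanDouble k) : Commute c (φ a) := by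
  induction a using gen_induction with
  | algebraMap r => rw [AlgHom.commutes]; exact Algebra.commute_algebraMap_right r c
  | gen i => exact h i
  | mul a b iha ihb => rw [map_mul]; exact iha.mul_right ihb
  | add a b iha ihb => rw [map_add]; exact iha.add_right ihb

variable [CharZero k]

theorem isNormalElement_q : IsNormalElement (q k) := by
  -- Both one-sided conditions are stable under sums and products, so they need checking only on
  -- generators.
  have key (a : JordanDouble k) : (∃ b, q k * a = b * q k) ∧ ∃ b, a * q k = q k * b := by
    have of {a} (h : Commute (q k) a) : (∃ b, q k * a = b * q k) ∧ ∃ b, a * q k = q k * b :=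
      ⟨⟨a, h.eq⟩, ⟨a, h.eq.symm⟩⟩
    induction a using gen_induction with
    | algebraMap r => exact of (Algebra.commute_algebraMap_right r _)
    | gen i =>
      cases i with
      | u => exact of (q_commute_u k)
      | g => exact of (q_commute_g k)
      | ginv => exact of (commute_ginv k (q_commute_g k))
      | x => exact of (q_commute_x k)
      | zeta => exact of (q_commute_zeta k)
      | y =>
        refine ⟨⟨_, q_mul_y k⟩, gen k .y - (1 / 2 : k) • gen k .x, ?_⟩
        rw [mul_sub, q_mul_y, mul_smul_comm, (q_commute_x k).eq, ← smul_mul_assoc, ← sub_mul,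
          add_sub_cancel_right]
      | v =>
        refine ⟨⟨_, q_mul_v k⟩, gen k .v + (1 / 2 : k) • gen k .u, ?_⟩
        rw [mul_add, q_mul_v, mul_smul_comm, (q_commute_u k).eq, ← smul_mul_assoc, ← add_mul,
          sub_add_cancel]
    | mul a b iha ihb =>
      obtain ⟨⟨a₁, ha₁⟩, a₂, ha₂⟩ := iha
      obtain ⟨⟨b₁, hb₁⟩, b₂, hb₂⟩ := ihb
      exact ⟨⟨a₁ * b₁, by rw [← mul_assoc, ha₁, mul_assoc, hb₁, mul_assoc]⟩,
        a₂ * b₂, by rw [mul_assoc, hb₂, ← mul_assoc, ha₂, mul_assoc]⟩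
    | add a b iha ihb =>
      obtain ⟨⟨a₁, ha₁⟩, a₂, ha₂⟩ := iha
      obtain ⟨⟨b₁, hb₁⟩, b₂, hb₂⟩ := ihb
      exact ⟨⟨a₁ + b₁, by rw [mul_add, add_mul, ha₁, hb₁]⟩,
        a₂ + b₂, by rw [mul_add, add_mul, ha₂, hb₂]⟩
  ext c
  constructor
  · rintro ⟨a, rfl⟩
    obtain ⟨-, b, hb⟩ := key a
    exact ⟨b, hb.symm⟩
  · rintro ⟨a, rfl⟩
    obtain ⟨⟨b, hb⟩, -⟩ := key a
    exact ⟨b, hb.symm⟩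

end Generators
end JordanDouble

/-! ### Ore localizations of algebras: universal property and reduction to numerators. -/

namespace OreLocalization

section Algebra

variable {k R T : Type*} [CommRing k] [Ring R] [Algebra k R] [Ring T] [Algebra k T]
  (S : Submonoid R) [OreSet S]

/-- The canonical map to an Ore localization, as a homomorphism of algebras. -/
def numeratorAlgHom (k : Type*) [CommRing k] [Algebra k R] : R →ₐ[k] OreLocalization S R :=
  { (numeratorRingHom : R →+* OreLocalization S R) with commutes' := fun _ => rfl }

variable {S}

theorem isUnit_numeratorAlgHom {s : R} (hs : s ∈ S) : IsUnit (numeratorAlgHom S k s) :=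
  numerator_isUnit (⟨s, hs⟩ : S)

theorem oreDiv_one_mul_numeratorAlgHom (s : S) :
    ((1 : R) /ₒ s) * numeratorAlgHom S k (s : R) = 1 :=
  (numeratorUnit s).inv_mul

theorem numeratorAlgHom_mul_oreDiv_one (s : S) :
    numeratorAlgHom S k (s : R) * ((1 : R) /ₒ s) = 1 :=
  (numeratorUnit s).mul_inv

/-- Clearing the denominator. As the image of the denominator is a unit, it can be cancelled
afterwards, which reduces equalities of homomorphisms and centrality to elements of `R`. -/
theorem exists_numeratorAlgHom_mul_eq (m : OreLocalization S R) :
    ∃ s ∈ S, ∃ a : R, numeratorAlgHom S k s * m = numeratorAlgHom S k a := by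
  induction m using OreLocalization.ind with
  | _ a s => exact ⟨s, s.2, a, OreLocalization.mul_cancel⟩

theorem ringHom_ext_numerator {B : Type*} [Ring B] {f g : OreLocalization S R →+* B}
    (h : ∀ a, f (numeratorAlgHom S k a) = g (numeratorAlgHom S k a)) : f = g := by
  ext m
  obtain ⟨s, hs, a, ha⟩ := exists_numeratorAlgHom_mul_eq (k := k) m
  have hu : IsUnit (f (numeratorAlgHom S k s)) := (isUnit_numeratorAlgHom hs).map f
  refine hu.mul_left_cancel ?_
  rw [← map_mul, ha, h, h s, ← map_mul, ha]

/-- The universal property of an Ore localization, for homomorphisms of algebras. -/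
noncomputable def liftAlgHom (f : R →ₐ[k] T) (hf : ∀ s ∈ S, IsUnit (f s)) :
    OreLocalization S R →ₐ[k] T :=
  { universalHom (f : R →+* T)
      (IsUnit.liftRight ((f : R →* T).comp S.subtype) fun s => hf s s.2) (fun _ => rfl) with
    commutes' := fun r => (universalHom_commutes (f : R →+* T) _ _).trans (f.commutes r) }

theorem liftAlgHom_numeratorAlgHom (f : R →ₐ[k] T) (hf : ∀ s ∈ S, IsUnit (f s)) (a : R) :
    liftAlgHom f hf (numeratorAlgHom S k a) = f a :=
  universalHom_commutes (f : R →+* T) _ _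

theorem commute_of_commute_numeratorAlgHom {c : OreLocalization S R}
    (h : ∀ a, Commute c (numeratorAlgHom S k a)) (m : OreLocalization S R) : Commute c m := by
  obtain ⟨s, hs, a, ha⟩ := exists_numeratorAlgHom_mul_eq (k := k) m
  refine (isUnit_numeratorAlgHom (k := k) hs).mul_left_cancel ?_
  rw [← mul_assoc, ← mul_assoc, ← (h s).eq, mul_assoc, ha, (h a).eq]

end Algebra

end OreLocalization

theorem isUnit_map_of_mem_closure {M N F : Type*} [Monoid M] [Monoid N] [FunLike F M N]
    [MonoidHomClass F M N] (f : F) {s : Set M} (h : ∀ a ∈ s, IsUnit (f a)) {a : M}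
    (ha : a ∈ Submonoid.closure s) : IsUnit (f a) := by
  induction ha using Submonoid.closure_induction with
  | mem a ha => exact h a ha
  | one => rw [map_one]; exact isUnit_one
  | mul a b _ _ iha ihb => rw [map_mul]; exact iha.mul ihb

/-! ### Universal properties of the Weyl algebra and of its localization. -/

namespace WeylAlgebra

variable {n : ℕ} {R A : Type*} [CommRing R] [Ring A] [Algebra R A]

/-- Elements satisfying the canonical commutation relations. -/
structure IsWeylSystem (Q P : Fin n → A) : Prop where
  q_q : ∀ i j, Q i * Q j = Q j * Q i
  p_p : ∀ i j, P i * P j = P j * P i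
  p_q_self : ∀ i, P i * Q i = Q i * P i + 1
  p_q : ∀ i j, i ≠ j → P i * Q j = Q j * P i

/-- The universal property of the Weyl algebra. -/
noncomputable def lift (Q P : Fin n → A) (h : IsWeylSystem Q P) : WeylAlgebra n R →ₐ[R] A :=
  RingQuot.liftAlgHom R ⟨FreeAlgebra.lift R (Sum.elim Q P), fun a b hab => by
    cases hab with
    | q_q i j => simpa [freeQ] using h.q_q i j
    | p_p i j => simpa [freeP] using h.p_p i j
    | p_q_self i => simpa [freeQ, freeP] using h.p_q_self i
    | p_q i j hij => simpa [freeQ, freeP] using h.p_q i j hij⟩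

theorem lift_q (Q P : Fin n → A) (h : IsWeylSystem Q P) (i : Fin n) :
    lift Q P h (q n R i) = Q i := by
  unfold lift q mk
  erw [RingQuot.liftAlgHom_mkAlgHom_apply]
  simp [freeQ]

theorem lift_p (Q P : Fin n → A) (h : IsWeylSystem Q P) (i : Fin n) :
    lift Q P h (p n R i) = P i := by
  unfold lift p mk
  erw [RingQuot.liftAlgHom_mkAlgHom_apply]
  simp [freeP]

theorem generator_induction {C : WeylAlgebra n R → Prop}
    (algebraMap : ∀ r, C (algebraMap R _ r)) (q : ∀ i, C (q n R i)) (p : ∀ i, C (p n R i))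
    (mul : ∀ a b, C a → C b → C (a * b)) (add : ∀ a b, C a → C b → C (a + b))
    (a : WeylAlgebra n R) : C a := by
  obtain ⟨f, rfl⟩ := mk_surjective n R a
  induction f using FreeAlgebra.induction with
  | grade0 c => rw [AlgHom.commutes]; exact algebraMap c
  | grade1 i =>
    rcases i with i | i
    exacts [q i, p i]
  | mul a b iha ihb => rw [map_mul]; exact mul _ _ iha ihb
  | add a b iha ihb => rw [map_add]; exact add _ _ iha ihb

variable (n R) in
theorem isWeylSystem : IsWeylSystem (q n R) (p n R) where
  q_q i j := by simpa [q] using rel_eq n R (Rel.q_q i j)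
  p_p i j := by simpa [p] using rel_eq n R (Rel.p_p i j)
  p_q_self i := by simpa [p, q] using rel_eq n R (Rel.p_q_self i)
  p_q i j h := by simpa [p, q] using rel_eq n R (Rel.p_q i j h)

theorem IsWeylSystem.map {B F : Type*} [Ring B] [FunLike F A B] [RingHomClass F A B] (f : F)
    {Q P : Fin n → A} (h : IsWeylSystem Q P) :
    IsWeylSystem (fun i => f (Q i)) (fun i => f (P i)) where
  q_q i j := by rw [← map_mul, h.q_q, map_mul]
  p_p i j := by rw [← map_mul, h.p_p, map_mul]
  p_q_self i := by rw [← map_mul, h.p_q_self, map_add, map_mul, map_one]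
  p_q i j hij := by rw [← map_mul, h.p_q i j hij, map_mul]

end WeylAlgebra

namespace WeylAlgebraLoc

open OreLocalization

variable {n : ℕ} {R A : Type*} [CommRing R] [Ring A] [Algebra R A]

variable (n R) in
/-- The canonical map `A_n(R) → A'_n(R)`. -/
noncomputable def ofWeyl : WeylAlgebra n R →ₐ[R] WeylAlgebraLoc n R :=
  numeratorAlgHom (WeylAlgebra.denominators n R) R

/-- The universal property of the localized Weyl algebra. -/
noncomputable def lift (Q P : Fin n → A) (h : WeylAlgebra.IsWeylSystem Q P)
    (hQ : ∀ i, IsUnit (Q i)) : WeylAlgebraLoc n R →ₐ[R] A :=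
  liftAlgHom (WeylAlgebra.lift Q P h) fun s hs => isUnit_map_of_mem_closure _ (by
    rintro _ ⟨i, rfl⟩
    rw [WeylAlgebra.lift_q]
    exact hQ i) hs

theorem lift_q (Q P : Fin n → A) (h : WeylAlgebra.IsWeylSystem Q P)
    (hQ : ∀ i, IsUnit (Q i)) (i : Fin n) :
    lift Q P h hQ (ofWeyl n R (WeylAlgebra.q n R i)) = Q i :=
  (liftAlgHom_numeratorAlgHom _ _ _).trans (WeylAlgebra.lift_q Q P h i)

theorem lift_p (Q P : Fin n → A) (h : WeylAlgebra.IsWeylSystem Q P)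
    (hQ : ∀ i, IsUnit (Q i)) (i : Fin n) :
    lift Q P h hQ (ofWeyl n R (WeylAlgebra.p n R i)) = P i :=
  (liftAlgHom_numeratorAlgHom _ _ _).trans (WeylAlgebra.lift_p Q P h i)

theorem isUnit_q (i : Fin n) : IsUnit (ofWeyl n R (WeylAlgebra.q n R i)) :=
  isUnit_numeratorAlgHom (Submonoid.subset_closure ⟨i, rfl⟩)

theorem ringHom_ext {B : Type*} [Ring B] {f g : WeylAlgebraLoc n R →+* B}
    (hR : ∀ r, f (algebraMap R _ r) = g (algebraMap R _ r))
    (hq : ∀ i, f (ofWeyl n R (WeylAlgebra.q n R i)) = g (ofWeyl n R (WeylAlgebra.q n R i)))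
    (hp : ∀ i, f (ofWeyl n R (WeylAlgebra.p n R i)) = g (ofWeyl n R (WeylAlgebra.p n R i))) :
    f = g := by
  refine ringHom_ext_numerator (k := R) fun a => ?_
  change f (ofWeyl n R a) = g (ofWeyl n R a)
  induction a using WeylAlgebra.generator_induction with
  | algebraMap r => rw [AlgHom.commutes]; exact hR r
  | q i => exact hq i
  | p i => exact hp i
  | mul a b iha ihb => rw [map_mul, map_mul, map_mul, iha, ihb]
  | add a b iha ihb => rw [map_add, map_add, map_add, iha, ihb]

end WeylAlgebraLoc

/-! ### The Weyl system and the central elements of `𝒟′`. -/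

namespace JordanDoubleLoc

open JordanDouble OreLocalization

variable (k : Type*) [Field k]

/-- The canonical map `𝒟 → 𝒟′` as a homomorphism of algebras. -/
noncomputable def ofDAlgHom : JordanDouble k →ₐ[k] JordanDoubleLoc k :=
  numeratorAlgHom (denominators k) k

theorem ofD_apply (a : JordanDouble k) : ofD k a = ofDAlgHom k a := rfl

/-- The inverse of `x` in `𝒟′`. -/
noncomputable def xInv : JordanDoubleLoc k :=
  oreDiv 1 (⟨gen k .x, Submonoid.subset_closure (by simp)⟩ : denominators k)

theorem x_mul_xInv : ofDAlgHom k (gen k .x) * xInv k = 1 := numeratorAlgHom_mul_oreDiv_one _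

theorem xInv_mul_x : xInv k * ofDAlgHom k (gen k .x) = 1 := oreDiv_one_mul_numeratorAlgHom _

theorem q_mul_qInv : ofDAlgHom k (q k) * qInv k = 1 := numeratorAlgHom_mul_oreDiv_one _

theorem qInv_mul_q : qInv k * ofDAlgHom k (q k) = 1 := oreDiv_one_mul_numeratorAlgHom _

theorem x_mul_xInv_mul (a : JordanDoubleLoc k) : ofDAlgHom k (gen k .x) * (xInv k * a) = a := by
  rw [← mul_assoc, x_mul_xInv, one_mul]

theorem xInv_mul_x_mul (a : JordanDoubleLoc k) : xInv k * (ofDAlgHom k (gen k .x) * a) = a := by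
  rw [← mul_assoc, xInv_mul_x, one_mul]

theorem q_mul_qInv_mul (a : JordanDoubleLoc k) : ofDAlgHom k (q k) * (qInv k * a) = a := by
  rw [← mul_assoc, q_mul_qInv, one_mul]

theorem qInv_mul_q_mul (a : JordanDoubleLoc k) : qInv k * (ofDAlgHom k (q k) * a) = a := by
  rw [← mul_assoc, qInv_mul_q, one_mul]

variable {k} in
theorem commute_xInv {a : JordanDoubleLoc k} (h : Commute a (ofDAlgHom k (gen k .x))) :
    Commute a (xInv k) :=
  Commute.units_inv_right (u := ⟨_, _, x_mul_xInv k, xInv_mul_x k⟩) h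

variable {k} in
theorem commute_qInv {a : JordanDoubleLoc k} (h : Commute a (ofDAlgHom k (q k))) :
    Commute a (qInv k) :=
  Commute.units_inv_right (u := ⟨_, _, q_mul_qInv k, qInv_mul_q k⟩) h

variable {k} in
theorem mem_center_of_commute_gen {c : JordanDoubleLoc k}
    (h : ∀ i, Commute c (ofDAlgHom k (gen k i))) : c ∈ Subalgebra.center k (JordanDoubleLoc k) :=
  Subalgebra.mem_center_iff.2 fun m =>
    (commute_of_commute_numeratorAlgHom (commute_of_commute_gen (ofDAlgHom k) h) m).eq.symm

theorem z_mul_zInv : z k * zInv k = 1 := by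
  simp only [z, zInv, ofD_apply, JordanDouble.z, map_mul, mul_assoc]
  rw [← mul_assoc (ofDAlgHom k (gen k .ginv)), ← map_mul, ginv_mul_g, map_one, one_mul,
    map_pow, pow_two, pow_two, mul_assoc, q_mul_qInv_mul, q_mul_qInv]

theorem zInv_mul_z : zInv k * z k = 1 := by
  simp only [z, zInv, ofD_apply, JordanDouble.z, map_mul, mul_assoc]
  rw [map_pow, pow_two, pow_two, mul_assoc, mul_assoc, qInv_mul_q_mul, qInv_mul_q_mul, ← map_mul,
    g_mul_ginv, map_one]

/-- The Euler operator of `q`. -/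
noncomputable def theta : JordanDoubleLoc k :=
  -((2 : k) • (xInv k * ofDAlgHom k (gen k .y))) - ofDAlgHom k (gen k .zeta)

/-- Together with `map_g`, `map_ginv`, `map_y` and `map_v`, this recovers the generators of `𝒟` from
x^{±1}, q^{±1}, z^{±1}, z', ζ and θ. The formulas for u, y and v are those of
`EulerSystem.genImage`. -/
theorem map_u : ofDAlgHom k (gen k .u)
    = xInv k * (ofDAlgHom k (q k) - 2 - 2 * ofDAlgHom k (gen k .g)) := by
  have h : ofDAlgHom k (q k) - 2 - 2 * ofDAlgHom k (gen k .g)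
      = ofDAlgHom k (gen k .x) * ofDAlgHom k (gen k .u) := by
    rw [← map_mul, ← u_mul_x]
    simp only [q, map_add, map_mul, map_ofNat, mul_add, mul_one]
    abel
  rw [h, xInv_mul_x_mul]

theorem map_g : ofDAlgHom k (gen k .g) = zInv k * ofDAlgHom k (q k) ^ 2 := by
  rw [zInv, mul_assoc, pow_two, pow_two, mul_assoc, qInv_mul_q_mul, qInv_mul_q, mul_one, ofD_apply]

theorem map_ginv : ofDAlgHom k (gen k .ginv) = z k * qInv k ^ 2 := by
  have h : Commute (ofDAlgHom k (gen k .ginv)) (qInv k) :=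
    commute_qInv ((commute_ginv k (q_commute_g k)).symm.map (ofDAlgHom k))
  rw [z, ofD_apply, JordanDouble.z, map_mul, mul_assoc, (h.pow_right 2).eq, map_pow, pow_two,
    pow_two, mul_assoc, mul_assoc, q_mul_qInv_mul, q_mul_qInv_mul]

theorem map_s : ofDAlgHom k (s k) = ofDAlgHom k (q k) * zPrime k := by
  rw [zPrime, q_mul_qInv_mul, ofD_apply]

theorem zeta_mul_xInv : ofDAlgHom k (gen k .zeta) * xInv k
    = xInv k * ofDAlgHom k (gen k .zeta) - xInv k := by
  have h : ofDAlgHom k (gen k .x) * ofDAlgHom k (gen k .zeta)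
      = ofDAlgHom k (gen k .zeta) * ofDAlgHom k (gen k .x) - ofDAlgHom k (gen k .x) := by
    rw [← map_mul, ← map_mul, zeta_mul_x, map_add, add_sub_cancel_right]
  calc _ = xInv k * (ofDAlgHom k (gen k .x) * ofDAlgHom k (gen k .zeta)) * xInv k := by
        rw [xInv_mul_x_mul]
    _ = xInv k * ofDAlgHom k (gen k .zeta) * (ofDAlgHom k (gen k .x) * xInv k)
        - xInv k * (ofDAlgHom k (gen k .x) * xInv k) := by rw [h]; noncomm_ring
    _ = _ := by rw [x_mul_xInv, mul_one, mul_one]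

/-- The coordinates `q_1 = x` and `q_2 = q` of `𝒟′`. -/
noncomputable def coordinate : Fin 2 → JordanDoubleLoc k :=
  ![ofDAlgHom k (gen k .x), ofDAlgHom k (q k)]

/-- The derivations `p_1 = x⁻¹ ζ` and `p_2 = q⁻¹ θ` of `𝒟′`. -/
noncomputable def momentum : Fin 2 → JordanDoubleLoc k :=
  ![xInv k * ofDAlgHom k (gen k .zeta), qInv k * theta k]

theorem isUnit_coordinate (i : Fin 2) : IsUnit (coordinate k i) := by
  fin_cases i
  · exact isUnit_numeratorAlgHom (Submonoid.subset_closure (by simp))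
  · exact isUnit_numeratorAlgHom (Submonoid.subset_closure (by simp))

/-- Both x and y have weight 1 for ad ζ, so x⁻¹y has weight 0. -/
theorem commute_theta_zeta : Commute (theta k) (ofDAlgHom k (gen k .zeta)) := by
  have h : Commute (xInv k * ofDAlgHom k (gen k .y)) (ofDAlgHom k (gen k .zeta)) := by
    unfold Commute SemiconjBy
    rw [← mul_assoc, zeta_mul_xInv, sub_mul, mul_assoc, mul_assoc,
      ← map_mul (ofDAlgHom k) (gen k .zeta), zeta_mul_y, map_add, mul_add, add_sub_cancel_right,
      map_mul]
  exact ((h.smul_left _).neg_left).sub_left (Commute.refl _)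

variable [CharZero k]

theorem commute_s_qInv : Commute (ofDAlgHom k (s k)) (qInv k) :=
  commute_qInv ((commute_s_q k).map (ofDAlgHom k))

theorem zPrime_eq_s_mul_qInv : zPrime k = ofD k (s k) * qInv k :=
  (commute_s_qInv k).eq.symm

theorem z_mem_center : z k ∈ Subalgebra.center k (JordanDoubleLoc k) :=
  mem_center_of_commute_gen fun i => (commute_z_gen k i).map (ofDAlgHom k)

/-- The definition of s solved for xv, with -½ux + g - 1 rewritten as 2g - ½q. -/
theorem map_x_mul_map_v : ofDAlgHom k (gen k .x) * ofDAlgHom k (gen k .v)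
    = ofDAlgHom k (q k) * zPrime k - ofDAlgHom k (gen k .u) * ofDAlgHom k (gen k .y)
      - (2 * ofDAlgHom k (gen k .g) - (1 / 2 : k) • ofDAlgHom k (q k)) * ofDAlgHom k (gen k .zeta)
      + 2 * (1 + ofDAlgHom k (gen k .g)) := by
  have h22 : (2 : JordanDoubleLoc k) = 1 + 1 := one_add_one_eq_two.symm
  rw [← map_s, s, q]
  simp only [map_add, map_sub, map_mul, map_neg, map_smul, map_ofNat, map_one]
  simp only [mul_add, add_mul, sub_mul, neg_mul, smul_mul_assoc, smul_add, one_mul, mul_one, h22]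
  module

theorem zPrime_mem_center : zPrime k ∈ Subalgebra.center k (JordanDoubleLoc k) := by
  obtain ⟨hx, hg, hu, hζ, hy⟩ := s_commutation k
  have of {a} (hs : Commute (s k) a) (hq : Commute (q k) a) :
      Commute (zPrime k) (ofDAlgHom k a) :=
    (commute_qInv (hq.symm.map (ofDAlgHom k))).symm.mul_left (hs.map (ofDAlgHom k))
  have cx := of hx (q_commute_x k)
  have cg := of hg (q_commute_g k)
  have cu := of hu (q_commute_u k)
  have cζ := of hζ (q_commute_zeta k)
  have cq := of (commute_s_q k) (Commute.refl _)
  have cy : Commute (zPrime k) (ofDAlgHom k (gen k .y)) := by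
    -- The twist from moving q⁻¹ past y undoes the twist from moving s past y.
    have h : qInv k * ofDAlgHom k (gen k .y + (1 / 2 : k) • gen k .x)
        = ofDAlgHom k (gen k .y) * qInv k := by
      calc _ = qInv k * (ofDAlgHom k (gen k .y + (1 / 2 : k) • gen k .x)
              * ofDAlgHom k (q k)) * qInv k := by
            rw [mul_assoc, mul_assoc, q_mul_qInv, mul_one]
        _ = _ := by rw [← map_mul, ← q_mul_y, map_mul, qInv_mul_q_mul]
    unfold Commute SemiconjBy zPrime
    rw [mul_assoc, ofD_apply, ← map_mul, hy, map_mul, ← mul_assoc, h, mul_assoc]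
  refine mem_center_of_commute_gen fun i => ?_
  cases i with
  | u => exact cu
  | g => exact cg
  | ginv => exact of (commute_ginv k hg) (commute_ginv k (q_commute_g k))
  | x => exact cx
  | zeta => exact cζ
  | y => exact cy
  | v =>
    -- The product xv is a polynomial in z' and in elements already known to commute with z';
    -- multiplying by x⁻¹ then gives v.
    have h : Commute (zPrime k) (ofDAlgHom k (gen k .x) * ofDAlgHom k (gen k .v)) := by
      rw [map_x_mul_map_v]
      exact ((((cq.mul_right (Commute.refl _)).sub_right (cu.mul_right cy)).sub_right
        ((((Commute.ofNat_right _ 2).mul_right cg).sub_right (cq.smul_right _)).mul_right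
          cζ)).add_right ((Commute.ofNat_right _ 2).mul_right ((Commute.one_right _).add_right cg)))
    have h' := (commute_xInv cx).mul_right h
    rwa [xInv_mul_x_mul] at h'

theorem map_y : ofDAlgHom k (gen k .y)
    = -((1 / 2 : k) • (ofDAlgHom k (gen k .x) * (theta k + ofDAlgHom k (gen k .zeta)))) := by
  rw [theta, sub_add_cancel, mul_neg, mul_smul_comm, x_mul_xInv_mul]
  module

theorem map_v : ofDAlgHom k (gen k .v)
    = xInv k * (ofDAlgHom k (q k) * zPrime k + 2 + 2 * ofDAlgHom k (gen k .g)
      + ((1 / 2 : k) • ofDAlgHom k (q k) - 1 - ofDAlgHom k (gen k .g))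
        * (theta k + ofDAlgHom k (gen k .zeta))
      + ((1 / 2 : k) • ofDAlgHom k (q k) - 2 * ofDAlgHom k (gen k .g))
        * ofDAlgHom k (gen k .zeta)) := by
  have h22 : (2 : JordanDoubleLoc k) = 1 + 1 := one_add_one_eq_two.symm
  have hux : ofDAlgHom k (gen k .u) * ofDAlgHom k (gen k .x)
      = ofDAlgHom k (q k) - 2 - 2 * ofDAlgHom k (gen k .g) := by
    rw [← map_mul]
    simp only [q, map_add, map_mul, map_ofNat, mul_add, mul_one]
    abel
  have h := map_x_mul_map_v k
  rw [map_y, mul_neg, mul_smul_comm, ← mul_assoc (ofDAlgHom k (gen k .u)), hux] at h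
  rw [← xInv_mul_x_mul k (ofDAlgHom k (gen k .v)), h]
  congr 1
  simp only [mul_add, add_mul, sub_mul, smul_mul_assoc, smul_add, smul_sub, one_mul, mul_one, h22]
  module

/-- From yx = xy - ½x² one gets [-2x⁻¹y, x] = x, which cancels [ζ, x] = x. -/
theorem commute_theta_x : Commute (theta k) (ofDAlgHom k (gen k .x)) := by
  unfold Commute SemiconjBy theta
  rw [sub_mul, mul_sub, neg_mul, mul_neg, smul_mul_assoc, mul_smul_comm, x_mul_xInv_mul, mul_assoc,
    ← map_mul, ← map_mul, y_mul_x, zeta_mul_x]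
  simp only [map_sub, map_add, map_mul, map_smul, mul_sub, mul_smul_comm, xInv_mul_x_mul]
  module

/-- Since ζ commutes with q, only y contributes: [y, q] = -½xq, and the factor -2x⁻¹ turns this into
q. -/
theorem theta_mul_q : theta k * ofDAlgHom k (q k)
    = ofDAlgHom k (q k) * theta k + ofDAlgHom k (q k) := by
  have hζ : ofDAlgHom k (q k) * ofDAlgHom k (gen k .zeta)
      = ofDAlgHom k (gen k .zeta) * ofDAlgHom k (q k) := ((q_commute_zeta k).map (ofDAlgHom k)).eq
  have hx : ofDAlgHom k (q k) * xInv k = xInv k * ofDAlgHom k (q k) :=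
    commute_xInv ((q_commute_x k).map (ofDAlgHom k))
  unfold theta
  rw [sub_mul, mul_sub, neg_mul, mul_neg, smul_mul_assoc, mul_smul_comm, ← mul_assoc _ (xInv k), hx,
    mul_assoc, mul_assoc, ← map_mul _ (q k), q_mul_y, hζ]
  simp only [map_add, map_mul, map_smul, add_mul, mul_add, smul_mul_assoc, mul_smul_comm,
    xInv_mul_x_mul]
  module

theorem isWeylSystem : WeylAlgebra.IsWeylSystem (coordinate k) (momentum k) := by
  have qx : Commute (ofDAlgHom k (q k)) (ofDAlgHom k (gen k .x)) :=
    (q_commute_x k).map (ofDAlgHom k)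
  have qζ : Commute (ofDAlgHom k (q k)) (ofDAlgHom k (gen k .zeta)) :=
    (q_commute_zeta k).map (ofDAlgHom k)
  have pp : Commute (xInv k * ofDAlgHom k (gen k .zeta)) (qInv k * theta k) :=
    ((commute_qInv (commute_xInv qx).symm).mul_left (commute_qInv qζ.symm)).mul_right
      ((commute_xInv (commute_theta_x k)).symm.mul_left (commute_theta_zeta k).symm)
  have p1q2 : Commute (xInv k * ofDAlgHom k (gen k .zeta)) (ofDAlgHom k (q k)) :=
    (commute_xInv qx).symm.mul_left qζ.symm
  have p2q1 : Commute (qInv k * theta k) (ofDAlgHom k (gen k .x)) :=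
    (commute_qInv qx.symm).symm.mul_left (commute_theta_x k)
  constructor
  · intro i j
    fin_cases i <;> fin_cases j
    exacts [rfl, qx.eq.symm, qx.eq, rfl]
  · intro i j
    fin_cases i <;> fin_cases j
    exacts [rfl, pp.eq, pp.eq.symm, rfl]
  · intro i
    fin_cases i
    · change xInv k * ofDAlgHom k (gen k .zeta) * ofDAlgHom k (gen k .x)
        = ofDAlgHom k (gen k .x) * (xInv k * ofDAlgHom k (gen k .zeta)) + 1
      rw [x_mul_xInv_mul, mul_assoc, ← map_mul, zeta_mul_x, map_add, map_mul, mul_add,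
        xInv_mul_x_mul, xInv_mul_x]
    · change qInv k * theta k * ofDAlgHom k (q k) = ofDAlgHom k (q k) * (qInv k * theta k) + 1
      rw [q_mul_qInv_mul, mul_assoc, theta_mul_q, mul_add, qInv_mul_q_mul, qInv_mul_q]
  · intro i j hij
    fin_cases i <;> fin_cases j
    exacts [absurd rfl hij, p1q2.eq, p2q1.eq, absurd rfl hij]

end JordanDoubleLoc

/-! ### The center of an algebra generated by a Weyl system, by eigenvalue arguments. -/

/-- A vector in a sum of subspaces of distinct eigenspaces which is itself an eigenvector lies in
one of these subspaces. -/
theorem Module.End.mem_of_mem_iSup_of_mem_eigenspace {K M ι : Type*} [Field K] [AddCommGroup M]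
    [Module K M] (f : Module.End K M) (V : ι → Submodule K M) {μ : ι → K}
    (hμ : Function.Injective μ) (hV : ∀ i, V i ≤ f.eigenspace (μ i)) {x : M} (hx : x ∈ ⨆ i, V i)
    {i : ι} (hi : x ∈ f.eigenspace (μ i)) : x ∈ V i := by
  -- Split off a component in `V i`. The remainder is an eigenvector for `μ i` lying in the sum of
  -- the other eigenspaces, so it vanishes.
  rw [iSup_split_single _ i, Submodule.mem_sup] at hx
  obtain ⟨y, hy, z, hz, rfl⟩ := hx
  have hz' : z ∈ ⨆ j, ⨆ (_ : j ≠ i), f.eigenspace (μ j) :=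
    (iSup₂_mono fun j _ => hV j : (⨆ j, ⨆ (_ : j ≠ i), V j) ≤ _) hz
  have hz'' : z ∈ f.eigenspace (μ i) := by
    simpa using Submodule.sub_mem _ hi (hV i hy)
  have h := (f.eigenspaces_iSupIndep.comp hμ) i
  rw [Submodule.disjoint_def.1 h z hz'' hz', add_zero]
  exact hy

namespace WeylAlgebra

section Center

variable {k A : Type*} [Field k] [Ring A] [Algebra k A]

theorem commutator_zpow {q : Aˣ} {t : A} (h : t * q = q * t + q) (m : ℤ) :
    t * ↑(q ^ m) = ↑(q ^ m) * t + (m : A) * ↑(q ^ m) := by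
  have hi : t * ↑q⁻¹ = ↑q⁻¹ * t - ↑q⁻¹ := by
    have h' : t = q * t * ↑q⁻¹ + 1 := by
      rw [← q.mul_inv, ← add_mul, ← h, mul_assoc, q.mul_inv, mul_one]
    conv_rhs => rw [h']
    rw [mul_add, mul_one, add_sub_cancel_right, mul_assoc, q.inv_mul_cancel_left]
  induction m using Int.induction_on with
  | zero => simp
  | succ m ih =>
    rw [zpow_add_one, Units.val_mul, ← mul_assoc, ih, add_mul, mul_assoc, h]
    push_cast
    noncomm_ring
  | pred m ih =>
    rw [zpow_sub_one, Units.val_mul, ← mul_assoc, ih, add_mul, mul_assoc, hi]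
    push_cast
    noncomm_ring

/-- The adjoined algebra is contained in the sum of the spaces B qᵐ, and ad t acts on B qᵐ by the
integer m. Commuting with t means eigenvalue 0, and distinct integers stay distinct in
characteristic 0, so only B q⁰ = B is left. -/
theorem mem_of_commute_of_mem_adjoin [CharZero k] (B : Subalgebra k A) (q : Aˣ) (t : A)
    (ht : t * q = q * t + q) (hBq : ∀ b ∈ B, Commute b (q : A)) (hBt : ∀ b ∈ B, Commute b t)
    {c : A} (hc : c ∈ Algebra.adjoin k ((B : Set A) ∪ {(q : A), ↑q⁻¹})) (hct : Commute c t) :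
    c ∈ B := by
  let f : Module.End k A := LinearMap.mulLeft k t - LinearMap.mulRight k t
  let V : ℤ → Submodule k A := fun m => B.toSubmodule.map (LinearMap.mulRight k ↑(q ^ m))
  have hV (m : ℤ) : V m ≤ f.eigenspace (m : k) := by
    rintro _ ⟨b, hb, rfl⟩
    rw [Module.End.mem_eigenspace_iff]
    change t * (b * ↑(q ^ m)) - b * ↑(q ^ m) * t = (m : k) • (b * ↑(q ^ m))
    rw [← mul_assoc, ← (hBt b hb).eq, mul_assoc, mul_assoc, commutator_zpow ht, mul_add,
      add_sub_cancel_left,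
      Algebra.smul_def, map_intCast, ← mul_assoc, ← mul_assoc, (Int.cast_commute m b).eq]
  -- The sum of the `V m` is stable under left multiplication; as it contains 1, it contains the
  -- adjoined algebra.
  have hN : ∀ a ∈ Algebra.adjoin k ((B : Set A) ∪ {(q : A), ↑q⁻¹}), ∀ v ∈ ⨆ m, V m,
      a * v ∈ ⨆ m, V m := by
    intro a ha
    induction ha using Algebra.adjoin_induction with
    | algebraMap r =>
      intro v hv
      rw [← Algebra.smul_def]
      exact Submodule.smul_mem _ _ hv
    | add a b _ _ iha ihb =>
      intro v hv
      rw [add_mul]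
      exact Submodule.add_mem _ (iha v hv) (ihb v hv)
    | mul a b _ _ iha ihb =>
      intro v hv
      rw [mul_assoc]
      exact iha _ (ihb v hv)
    | mem a ha =>
      have key : ∀ m, ∃ m', ∀ v ∈ V m, a * v ∈ V m' := by
        intro m
        rcases ha with ha | rfl | rfl
        · refine ⟨m, ?_⟩
          rintro _ ⟨b, hb, rfl⟩
          exact ⟨a * b, B.mul_mem ha hb, mul_assoc _ _ _⟩
        · refine ⟨1 + m, ?_⟩
          rintro _ ⟨b, hb, rfl⟩
          refine ⟨b, hb, ?_⟩
          change b * ↑(q ^ (1 + m)) = q * (b * ↑(q ^ m))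
          rw [zpow_one_add, Units.val_mul, ← mul_assoc, (hBq b hb).eq, mul_assoc]
        · refine ⟨-1 + m, ?_⟩
          rintro _ ⟨b, hb, rfl⟩
          refine ⟨b, hb, ?_⟩
          change b * ↑(q ^ (-1 + m)) = ↑q⁻¹ * (b * ↑(q ^ m))
          rw [zpow_add, zpow_neg_one, Units.val_mul, ← mul_assoc, (hBq b hb).units_inv_right.eq,
            mul_assoc]
      intro v hv
      induction hv using Submodule.iSup_induction' with
      | mem m v hv =>
        obtain ⟨m', h⟩ := key m
        exact Submodule.mem_iSup_of_mem m' (h v hv)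
      | zero => rw [mul_zero]; exact Submodule.zero_mem _
      | add v w _ _ ihv ihw => rw [mul_add]; exact Submodule.add_mem _ ihv ihw
  have h1 : (1 : A) ∈ ⨆ m, V m := Submodule.mem_iSup_of_mem 0 ⟨1, one_mem B, by simp⟩
  have hc0 : c ∈ V 0 := by
    refine Module.End.mem_of_mem_iSup_of_mem_eigenspace f V (μ := fun m : ℤ => (m : k))
      Int.cast_injective hV (mul_one c ▸ hN c hc 1 h1) ?_
    rw [Module.End.mem_eigenspace_iff]
    change t * c - c * t = _
    rw [hct.eq, sub_self, Int.cast_zero, zero_smul]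
  obtain ⟨b, hb, rfl⟩ := hc0
  simpa using hb

variable (k) in
theorem commute_of_mem_adjoin {s : Set A} {a b : A} (h : ∀ c ∈ s, Commute c a)
    (hb : b ∈ Algebra.adjoin k s) : Commute b a := by
  induction hb using Algebra.adjoin_induction with
  | mem b hb => exact h b hb
  | algebraMap r => exact Algebra.commute_algebraMap_left r a
  | add b c _ _ ihb ihc => exact ihb.add_left ihc
  | mul b c _ _ ihb ihc => exact ihb.mul_left ihc

variable {n : ℕ} {u : Fin n → Aˣ} {P : Fin n → A}

/-- The coordinates are removed one at a time. The Euler operator `u i * P i` detects the degree in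
`u i` and commutes with the coordinates that remain. -/
theorem mem_of_mem_center_of_mem_adjoin_finset [CharZero k]
    (h : IsWeylSystem (fun i => (u i : A)) P) (C : Subalgebra k A)
    (hC : C ≤ Subalgebra.center k A) (s : Finset (Fin n)) {c : A}
    (hcc : c ∈ Subalgebra.center k A)
    (hc : c ∈ Algebra.adjoin k ((C : Set A) ∪ {a | ∃ i ∈ s, a = u i ∨ a = ↑(u i)⁻¹})) :
    c ∈ C := by
  have comm {a b : A} (hb : b ∈ Subalgebra.center k A) : Commute b a :=
    (Subalgebra.mem_center_iff.1 hb a).symm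
  induction s using Finset.induction_on generalizing c with
  | empty => simpa [Algebra.adjoin_eq] using hc
  | insert i s hi ih =>
    have key {a : A} (ha : ∀ j ∈ s, Commute (u j : A) a) :
        ∀ b ∈ Algebra.adjoin k ((C : Set A) ∪ {a | ∃ i ∈ s, a = u i ∨ a = ↑(u i)⁻¹}),
          Commute b a := by
      refine fun b hb => commute_of_mem_adjoin k ?_ hb
      rintro b (hb | ⟨j, hj, rfl | rfl⟩)
      · exact comm (hC hb)
      · exact ha j hj
      · exact (ha j hj).units_inv_left
    have hq (j : Fin n) : Commute (u j : A) (u i) := h.q_q j i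
    refine ih hcc (mem_of_commute_of_mem_adjoin _ (u i) (u i * P i) ?_ (key fun j _ => hq j)
      (key fun j hj => (hq j).mul_right ?_) (Algebra.adjoin_mono ?_ hc) (comm hcc))
    · rw [mul_assoc, h.p_q_self, mul_add, mul_one]
    · exact (h.p_q i j (by rintro rfl; exact hi hj)).symm
    · rintro a (ha | ⟨j, hj, ha⟩)
      · exact Or.inl (Algebra.subset_adjoin (Or.inl ha))
      · rcases Finset.mem_insert.1 hj with rfl | hj
        · exact Or.inr ha
        · exact Or.inl (Algebra.subset_adjoin (Or.inr ⟨j, hj, ha⟩))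

variable (k) (u P) in
/-- The elements of the form `∑ b_{i_1 … i_d} p_{i_1} ⋯ p_{i_d}` with coefficients in `B`. -/
def homogeneous (B : Subalgebra k A) : ℕ → Submodule k A
  | 0 => B.toSubmodule
  | d + 1 => ⨆ i, (homogeneous B d).map (LinearMap.mulRight k (P i))

theorem mul_mem_homogeneous_succ (B : Subalgebra k A) {d : ℕ} {a : A}
    (ha : a ∈ homogeneous k P B d) (i : Fin n) : a * P i ∈ homogeneous k P B (d + 1) :=
  Submodule.mem_iSup_of_mem i ⟨a, ha, rfl⟩

theorem homogeneous_succ_induction (B : Subalgebra k A) {d : ℕ} (C : A → Prop) (zero : C 0)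
    (add : ∀ a b, C a → C b → C (a + b))
    (mul : ∀ a ∈ homogeneous k P B d, ∀ i, C (a * P i)) {a : A}
    (ha : a ∈ homogeneous k P B (d + 1)) : C a := by
  induction ha using Submodule.iSup_induction' with
  | mem i a ha =>
    obtain ⟨a, ha, rfl⟩ := ha
    exact mul a ha i
  | zero => exact zero
  | add a b _ _ iha ihb => exact add a b iha ihb

theorem mul_mem_homogeneous (B : Subalgebra k A) {b : A} (hb : b ∈ B) (d : ℕ) :
    ∀ a ∈ homogeneous k P B d, b * a ∈ homogeneous k P B d := by
  induction d with
  | zero => exact fun a ha => B.mul_mem hb ha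
  | succ d ih =>
    intro a ha
    refine homogeneous_succ_induction B (fun a => b * a ∈ _) ?_ (fun a b iha ihb => ?_) (fun a ha i => ?_) ha
    · rw [mul_zero]
      exact Submodule.zero_mem _
    · rw [mul_add]
      exact Submodule.add_mem _ iha ihb
    · rw [← mul_assoc]
      exact mul_mem_homogeneous_succ B (ih a ha) i

/-- Moving `P i` to the right past a coefficient b costs [P i, b], again a coefficient, so the error
term has one letter fewer. -/
theorem p_mul_mem_iSup_homogeneous (B : Subalgebra k A)
    (hB : ∀ b ∈ B, ∀ i, P i * b - b * P i ∈ B) (i : Fin n)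
    (d : ℕ) : ∀ a ∈ homogeneous k P B d,
      P i * a ∈ homogeneous k P B (d + 1) ⊔ homogeneous k P B d := by
  induction d with
  | zero =>
    intro a ha
    rw [← add_sub_cancel (a * P i) (P i * a)]
    exact Submodule.add_mem_sup (mul_mem_homogeneous_succ B ha i) (hB a ha i)
  | succ d ih =>
    intro a ha
    refine homogeneous_succ_induction B (fun a => P i * a ∈ _) ?_ (fun a b iha ihb => ?_) (fun a ha j => ?_) ha
    · rw [mul_zero]
      exact Submodule.zero_mem _
    · rw [mul_add]
      exact Submodule.add_mem _ iha ihb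
    · obtain ⟨b, hb, c, hc, h⟩ := Submodule.mem_sup.1 (ih a ha)
      rw [← mul_assoc, ← h, add_mul]
      exact Submodule.add_mem_sup (mul_mem_homogeneous_succ B hb j)
        (mul_mem_homogeneous_succ B hc j)

variable (k) in
/-- The operator `a ↦ ∑ [a, q_i] p_i`, which multiplies by `d` the elements of degree `d` in the
`p_i`. -/
def degreeOperator (Q P : Fin n → A) : Module.End k A :=
  ∑ i, LinearMap.mulRight k (P i) ∘ₗ (LinearMap.mulRight k (Q i) - LinearMap.mulLeft k (Q i))

theorem degreeOperator_apply (Q P : Fin n → A) (a : A) :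
    degreeOperator k Q P a = ∑ i, (a * Q i - Q i * a) * P i := by
  simp [degreeOperator]

/-- Commuting with q_i deletes the letters p_i of a word one at a time, and right multiplication by
p_i puts the deleted letter back because the p's commute. Summed over i, this counts the letters. -/
theorem homogeneous_le_eigenspace {Q P : Fin n → A} (h : IsWeylSystem Q P) (B : Subalgebra k A)
    (hB : ∀ b ∈ B, ∀ i, Commute b (Q i)) (d : ℕ) :
    homogeneous k P B d ≤ (degreeOperator k Q P).eigenspace (d : k) := by
  induction d with
  | zero =>
    intro a ha
    rw [Module.End.mem_eigenspace_iff, degreeOperator_apply, Nat.cast_zero, zero_smul]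
    exact Finset.sum_eq_zero fun i _ => by rw [(hB a ha i).eq, sub_self, zero_mul]
  | succ d ih =>
    intro a ha
    refine homogeneous_succ_induction B (fun a => a ∈ _) ?_ (fun a b iha ihb => ?_) (fun a ha j => ?_) ha
    · exact Submodule.zero_mem _
    · exact Submodule.add_mem _ iha ihb
    · have ha' := ih ha
      rw [Module.End.mem_eigenspace_iff, degreeOperator_apply] at ha' ⊢
      -- The Leibniz rule on a p_j, with [p_j, q_i] equal to 1 if i = j and to 0 otherwise.
      have key (i : Fin n) : (a * P j * Q i - Q i * (a * P j)) * P i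
          = (a * Q i - Q i * a) * P i * P j + if i = j then a * P j else 0 := by
        split_ifs with hij
        · subst hij
          rw [mul_assoc a, h.p_q_self]
          noncomm_ring
        · rw [mul_assoc a, h.p_q j i (Ne.symm hij), mul_assoc _ (P i), h.p_p i j]
          noncomm_ring
      rw [Finset.sum_congr rfl fun i _ => key i, Finset.sum_add_distrib, ← Finset.sum_mul, ha',
        Finset.sum_ite_eq' Finset.univ j, if_pos (Finset.mem_univ j), smul_mul_assoc]
      push_cast
      rw [add_smul, one_smul]

/-- The center of an algebra generated over central scalars `C` by the generators of a Weyl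
algebra and the inverses of the `q_i` is `C`. -/
theorem center_eq_of_isWeylSystem [CharZero k] (h : IsWeylSystem (fun i => (u i : A)) P)
    (C : Subalgebra k A) (hC : C ≤ Subalgebra.center k A)
    (hgen : Algebra.adjoin k ((C : Set A) ∪ {a | ∃ i, a = u i ∨ a = ↑(u i)⁻¹} ∪ Set.range P) = ⊤) :
    Subalgebra.center k A = C := by
  refine le_antisymm (fun c hc => ?_) hC
  have comm {a b : A} (hb : b ∈ Subalgebra.center k A) : Commute b a :=
    (Subalgebra.mem_center_iff.1 hb a).symm
  let B := Algebra.adjoin k ((C : Set A) ∪ {a | ∃ i ∈ Finset.univ, a = u i ∨ a = ↑(u i)⁻¹})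
  have hBQ : ∀ b ∈ B, ∀ i, Commute b (u i) := by
    refine fun b hb i => commute_of_mem_adjoin k ?_ hb
    rintro b (hb | ⟨j, -, rfl | rfl⟩)
    · exact comm (hC hb)
    · exact h.q_q j i
    · exact Commute.units_inv_left (h.q_q j i)
  have huB (i : Fin n) : (u i : A) ∈ B :=
    Algebra.subset_adjoin (Or.inr ⟨i, Finset.mem_univ i, Or.inl rfl⟩)
  have huB' (i : Fin n) : ((u i)⁻¹ : Aˣ) ∈ {v : Aˣ | (v : A) ∈ B} :=
    Algebra.subset_adjoin (Or.inr ⟨i, Finset.mem_univ i, Or.inr rfl⟩)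
  have hder (i j : Fin n) : P i * u j - u j * P i ∈ B := by
    by_cases hij : i = j
    · subst hij
      rw [h.p_q_self, add_sub_cancel_left]
      exact B.one_mem
    · rw [h.p_q i j hij, sub_self]
      exact B.zero_mem
  -- The derivation [P i, ·] preserves `B`; on inverses it is D(u⁻¹) = -u⁻¹ D(u) u⁻¹.
  have hBP : ∀ b ∈ B, ∀ i, P i * b - b * P i ∈ B := by
    intro b hb i
    induction hb using Algebra.adjoin_induction with
    | mem b hb =>
      rcases hb with hb | ⟨j, -, rfl | rfl⟩
      · rw [(comm (hC hb)).eq, sub_self]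
        exact B.zero_mem
      · exact hder i j
      · have e : P i * ↑(u j)⁻¹ - ↑(u j)⁻¹ * P i
            = -(↑(u j)⁻¹ * (P i * u j - u j * P i) * ↑(u j)⁻¹) := by
          rw [mul_sub, sub_mul, Units.inv_mul_cancel_left, mul_assoc, mul_assoc, Units.mul_inv,
            mul_one, neg_sub]
        rw [e]
        exact B.neg_mem (B.mul_mem (B.mul_mem (huB' j) (hder i j)) (huB' j))
    | algebraMap r =>
      rw [Algebra.commutes, sub_self]
      exact B.zero_mem
    | add b c hb hc ihb ihc =>
      convert B.add_mem ihb ihc using 1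
      noncomm_ring
    | mul b c hb hc ihb ihc =>
      convert B.add_mem (B.mul_mem ihb hc) (B.mul_mem hb ihc) using 1
      noncomm_ring
  -- This span is a left ideal containing 1, so every element is a sum of homogeneous ones.
  let N := ⨆ d, homogeneous k P B d
  have hN : ∀ a : A, ∀ v ∈ N, a * v ∈ N := by
    intro a
    have ha : a ∈ Algebra.adjoin k
        ((C : Set A) ∪ {a | ∃ i, a = u i ∨ a = ↑(u i)⁻¹} ∪ Set.range P) := hgen ▸ Algebra.mem_top
    induction ha using Algebra.adjoin_induction with
    | algebraMap r =>
      intro v hv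
      rw [← Algebra.smul_def]
      exact Submodule.smul_mem _ _ hv
    | add a b _ _ iha ihb =>
      intro v hv
      rw [add_mul]
      exact Submodule.add_mem _ (iha v hv) (ihb v hv)
    | mul a b _ _ iha ihb =>
      intro v hv
      rw [mul_assoc]
      exact iha _ (ihb v hv)
    | mem a ha =>
      intro v hv
      induction hv using Submodule.iSup_induction' with
      | zero => rw [mul_zero]; exact Submodule.zero_mem _
      | add v w _ _ ihv ihw => rw [mul_add]; exact Submodule.add_mem _ ihv ihw
      | mem d v hv =>
        have of (ha : a ∈ B) : a * v ∈ N :=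
          Submodule.mem_iSup_of_mem d (mul_mem_homogeneous B ha d v hv)
        rcases ha with (ha | ⟨i, rfl | rfl⟩) | ⟨i, rfl⟩
        · exact of (Algebra.subset_adjoin (Or.inl ha))
        · exact of (huB i)
        · exact of (huB' i)
        · exact sup_le (le_iSup (homogeneous k P B) (d + 1)) (le_iSup (homogeneous k P B) d)
            (p_mul_mem_iSup_homogeneous B hBP i d v hv)
  have h1 : (1 : A) ∈ N := Submodule.mem_iSup_of_mem 0 B.one_mem
  -- A central element commutes with every `u i`, so the degree operator kills it and it has degree
  -- 0 in the p's.
  have hcB : c ∈ homogeneous k P B 0 := by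
    refine Module.End.mem_of_mem_iSup_of_mem_eigenspace (degreeOperator k (fun i => (u i : A)) P)
      (homogeneous k P B) (μ := fun d : ℕ => (d : k)) Nat.cast_injective
      (homogeneous_le_eigenspace h B hBQ) (mul_one c ▸ hN c 1 h1) ?_
    rw [Module.End.mem_eigenspace_iff, degreeOperator_apply, Nat.cast_zero, zero_smul]
    exact Finset.sum_eq_zero fun i _ => by rw [(comm hc).eq, sub_self, zero_mul]
  exact mem_of_mem_center_of_mem_adjoin_finset h C hC Finset.univ hc hcB

end Center
end WeylAlgebra

/-! ### The localized Weyl algebra: faithfulness of scalars, center, Euler system. -/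

namespace WeylAlgebraLoc

open OreLocalization WeylAlgebra

section Generators

variable (n : ℕ) (R : Type*) [CommRing R]

/-- The action of `q_i` on functions on the lattice, by a shift. -/
def shiftQ (i : Fin n) : Module.End R ((Fin n → ℤ) → R) where
  toFun f m := f (m - Pi.single i 1)
  map_add' _ _ := rfl
  map_smul' _ _ := rfl

/-- The action of `p_i` on functions on the lattice. -/
def shiftP (i : Fin n) : Module.End R ((Fin n → ℤ) → R) where
  toFun f m := ((m i + 1 : ℤ) : R) * f (m + Pi.single i 1)
  map_add' _ _ := funext fun _ => mul_add _ _ _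
  map_smul' _ _ := funext fun _ => mul_left_comm _ _ _

/-- A function f stands for the formal series ∑ f(m) qᵐ over the lattice. The two operators are then
multiplication by q_i and ∂/∂q_i, so the coefficient of qᵐ in the derivative carries the old
exponent m_i + 1. -/
theorem isWeylSystem_shift : IsWeylSystem (shiftQ n R) (shiftP n R) where
  q_q i j := by
    ext1 f
    funext m
    change f (m - Pi.single i 1 - Pi.single j 1) = f (m - Pi.single j 1 - Pi.single i 1)
    rw [sub_right_comm]
  p_p i j := by
    ext1 f
    funext m
    rcases eq_or_ne i j with rfl | h
    · rfl
    change ((m i + 1 : ℤ) : R) * ((((m + Pi.single i 1 : Fin n → ℤ) j + 1 : ℤ) : R)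
        * f (m + Pi.single i 1 + Pi.single j 1))
      = ((m j + 1 : ℤ) : R) * ((((m + Pi.single j 1 : Fin n → ℤ) i + 1 : ℤ) : R)
        * f (m + Pi.single j 1 + Pi.single i 1))
    rw [add_right_comm m, Pi.add_apply, Pi.add_apply, Pi.single_eq_of_ne h,
      Pi.single_eq_of_ne h.symm, add_zero, add_zero, mul_left_comm]
  p_q_self i := by
    ext1 f
    funext m
    change ((m i + 1 : ℤ) : R) * f (m + Pi.single i 1 - Pi.single i 1)
      = (((m - Pi.single i 1 : Fin n → ℤ) i + 1 : ℤ) : R) * f (m - Pi.single i 1 + Pi.single i 1) + f m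
    rw [add_sub_cancel_right, sub_add_cancel, Pi.sub_apply, Pi.single_eq_same, sub_add_cancel]
    push_cast
    ring
  p_q i j h := by
    ext1 f
    funext m
    change ((m i + 1 : ℤ) : R) * f (m + Pi.single i 1 - Pi.single j 1)
      = (((m - Pi.single j 1 : Fin n → ℤ) i + 1 : ℤ) : R) * f (m - Pi.single j 1 + Pi.single i 1)
    rw [Pi.sub_apply, Pi.single_eq_of_ne h, sub_zero, sub_add_eq_add_sub]

theorem isUnit_shiftQ (i : Fin n) : IsUnit (shiftQ n R i) := by
  rw [Module.End.isUnit_iff]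
  refine Function.bijective_iff_has_inverse.2
    ⟨fun f m => f (m + Pi.single i 1), fun f => funext fun m => ?_, fun f => funext fun m => ?_⟩
  · change f (m + Pi.single i 1 - Pi.single i 1) = f m
    rw [add_sub_cancel_right]
  · change f (m - Pi.single i 1 + Pi.single i 1) = f m
    rw [sub_add_cancel]

/-- In the shift representation a scalar acts by multiplication, and its value is read off from its
action on the constant function 1 at the lattice point 0. -/
theorem algebraMap_injective :
    Function.Injective (algebraMap R (WeylAlgebraLoc n R)) := by
  intro a b h
  have h' := congrArg (lift _ _ (isWeylSystem_shift n R) (isUnit_shiftQ n R)) h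
  rw [AlgHom.commutes, AlgHom.commutes] at h'
  have h'' := congrFun (LinearMap.congr_fun h' fun _ => 1) 0
  simpa [Module.algebraMap_end_apply] using h''

/-- `q_i` as a unit of the localized Weyl algebra. -/
noncomputable def qUnit (i : Fin n) : (WeylAlgebraLoc n R)ˣ := (isUnit_q i).unit

variable {n R}

variable (n R) in
theorem isWeylSystem_qUnit : IsWeylSystem (fun i => (qUnit n R i : WeylAlgebraLoc n R))
    (fun i => ofWeyl n R (p n R i)) :=
  (isWeylSystem n R).map (ofWeyl n R)

theorem adjoin_generators_eq_top :
    Algebra.adjoin R ({a : WeylAlgebraLoc n R | ∃ i, a = qUnit n R i ∨ a = ↑(qUnit n R i)⁻¹}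
      ∪ Set.range fun i => ofWeyl n R (p n R i)) = ⊤ := by
  refine eq_top_iff.2 fun m _ => ?_
  set T := Algebra.adjoin R ({a : WeylAlgebraLoc n R | ∃ i, a = qUnit n R i ∨ a = ↑(qUnit n R i)⁻¹}
      ∪ Set.range fun i => ofWeyl n R (p n R i)) with hT
  have hW (a : WeylAlgebra n R) : ofWeyl n R a ∈ T := by
    induction a using generator_induction with
    | algebraMap r => rw [AlgHom.commutes]; exact T.algebraMap_mem r
    | q i => exact Algebra.subset_adjoin (Or.inl ⟨i, Or.inl rfl⟩)
    | p i => exact Algebra.subset_adjoin (Or.inr ⟨i, rfl⟩)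
    | mul a b iha ihb => rw [map_mul]; exact T.mul_mem iha ihb
    | add a b iha ihb => rw [map_add]; exact T.add_mem iha ihb
  -- The inverse of a product of the q_i is the reversed product of their inverses, so no further
  -- generators are needed for denominators.
  have hS : ∀ s ∈ denominators n R, ∃ t ∈ T, t * ofWeyl n R s = 1 := by
    intro s hs
    induction hs using Submonoid.closure_induction with
    | mem s hs =>
      obtain ⟨i, rfl⟩ := hs
      exact ⟨_, Algebra.subset_adjoin (Or.inl ⟨i, Or.inr rfl⟩), (qUnit n R i).inv_mul⟩
    | one => exact ⟨1, T.one_mem, by rw [map_one, one_mul]⟩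
    | mul a b _ _ iha ihb =>
      obtain ⟨c, hc, hc'⟩ := iha
      obtain ⟨d, hd, hd'⟩ := ihb
      refine ⟨d * c, T.mul_mem hd hc, ?_⟩
      rw [map_mul, mul_assoc, ← mul_assoc c, hc', one_mul, hd']
  obtain ⟨s, hs, a, ha⟩ := exists_numeratorAlgHom_mul_eq (k := R) m
  obtain ⟨t, ht, ht'⟩ := hS s hs
  have hm : m = t * ofWeyl n R a := by
    change ofWeyl n R s * m = ofWeyl n R a at ha
    rw [← ha, ← mul_assoc, ht', one_mul]
  rw [hm]
  exact T.mul_mem ht (hW a)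

end Generators

section Center

variable (k : Type*) [Field k] (n : ℕ) (R : Type*) [CommRing R] [Algebra k R]

theorem algebraMap_algebraMap (c : k) :
    algebraMap R (WeylAlgebraLoc n R) (algebraMap k R c) = algebraMap k (WeylAlgebraLoc n R) c :=
  rfl

/-- The structure map of the localized Weyl algebra, as a homomorphism of `k`-algebras. -/
noncomputable def scalars : R →ₐ[k] WeylAlgebraLoc n R :=
  { algebraMap R (WeylAlgebraLoc n R) with commutes' := algebraMap_algebraMap k n R }

theorem center_eq_range_scalars [CharZero k] :
    Subalgebra.center k (WeylAlgebraLoc n R) = (scalars k n R).range := by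
  refine center_eq_of_isWeylSystem (isWeylSystem_qUnit n R) _ ?_ (eq_top_iff.2 fun m _ => ?_)
  · rintro _ ⟨r, rfl⟩
    exact Subalgebra.mem_center_iff.2 fun m => (Algebra.commutes r m).symm
  -- Generation over `R` becomes generation over `k` once the image of `R` is among the generators.
  · have hm : m ∈ Algebra.adjoin R _ := adjoin_generators_eq_top (n := n) (R := R) ▸ Algebra.mem_top
    clear * - hm
    induction hm using Algebra.adjoin_induction with
    | mem m hm =>
      refine Algebra.subset_adjoin ?_
      rcases hm with hm | hm
      exacts [Or.inl (Or.inr hm), Or.inr hm]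
    | algebraMap r => exact Algebra.subset_adjoin (Or.inl (Or.inl ⟨r, rfl⟩))
    | add a b _ _ iha ihb => exact add_mem iha ihb
    | mul a b _ _ iha ihb => exact mul_mem iha ihb

end Center

section Euler

variable {R : Type*} [CommRing R]

/-- The Euler system in `A'_2(R)` with `x = q_1`, `q = q_2`, `g = t⁻¹ q_2²` and central parameter
`w`. -/
noncomputable def eulerSystem (t : Rˣ) (w : R) :
    JordanDouble.EulerSystem (WeylAlgebraLoc 2 R) where
  x := qUnit 2 R 0
  xi := ↑(qUnit 2 R 0)⁻¹
  q := qUnit 2 R 1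
  -- This makes q²g⁻¹ equal to t.
  g := algebraMap R _ ↑t⁻¹ * (qUnit 2 R 1 * qUnit 2 R 1)
  gi := algebraMap R _ ↑t * (↑(qUnit 2 R 1)⁻¹ * ↑(qUnit 2 R 1)⁻¹)
  w := algebraMap R _ w
  ζ := qUnit 2 R 0 * ofWeyl 2 R (p 2 R 0)
  θ := qUnit 2 R 1 * ofWeyl 2 R (p 2 R 1)
  x_mul_xi := Units.mul_inv _
  xi_mul_x := Units.inv_mul _
  g_mul_gi := by
    rw [(Algebra.commutes (↑t⁻¹ : R) _), mul_assoc, ← mul_assoc (algebraMap R _ _), ← map_mul,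
      Units.inv_mul, map_one, one_mul, mul_assoc, Units.mul_inv_cancel_left, Units.mul_inv]
  gi_mul_g := by
    rw [(Algebra.commutes (↑t : R) _), mul_assoc, ← mul_assoc (algebraMap R _ _), ← map_mul,
      Units.mul_inv, map_one, one_mul, mul_assoc, Units.inv_mul_cancel_left, Units.inv_mul]
  commute_x_q := (isWeylSystem_qUnit 2 R).q_q 0 1
  commute_x_g :=
    have h : Commute (qUnit 2 R 0 : WeylAlgebraLoc 2 R) (qUnit 2 R 1) := (isWeylSystem_qUnit 2 R).q_q 0 1
    (Algebra.commute_algebraMap_right _ _).mul_right (h.mul_right h)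
  commute_q_g := (Algebra.commute_algebraMap_right _ _).mul_right
    ((Commute.refl _).mul_right (Commute.refl _))
  commute_w a := Algebra.commute_algebraMap_right _ _
  ζ_mul_x := by
    rw [mul_assoc, (isWeylSystem_qUnit 2 R).p_q_self 0, mul_add, mul_one]
  ζ_mul_q := Commute.mul_left ((isWeylSystem_qUnit 2 R).q_q 0 1)
    ((isWeylSystem_qUnit 2 R).p_q 0 1 (by decide))
  ζ_mul_g :=
    have h : Commute ((qUnit 2 R 0 : WeylAlgebraLoc 2 R) * ofWeyl 2 R (p 2 R 0)) (qUnit 2 R 1) :=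
      Commute.mul_left ((isWeylSystem_qUnit 2 R).q_q 0 1)
        ((isWeylSystem_qUnit 2 R).p_q 0 1 (by decide))
    (Algebra.commute_algebraMap_right _ _).mul_right (h.mul_right h)
  θ_mul_x := Commute.mul_left ((isWeylSystem_qUnit 2 R).q_q 1 0)
    ((isWeylSystem_qUnit 2 R).p_q 1 0 (by decide))
  θ_mul_q := by
    rw [mul_assoc, (isWeylSystem_qUnit 2 R).p_q_self 1, mul_add, mul_one]
  θ_mul_g := by
    have h : (qUnit 2 R 1 : WeylAlgebraLoc 2 R) * ofWeyl 2 R (p 2 R 1) * qUnit 2 R 1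
        = qUnit 2 R 1 * (qUnit 2 R 1 * ofWeyl 2 R (p 2 R 1)) + qUnit 2 R 1 := by
      rw [mul_assoc, (isWeylSystem_qUnit 2 R).p_q_self 1, mul_add, mul_one]
    have h' : (qUnit 2 R 1 : WeylAlgebraLoc 2 R) * ofWeyl 2 R (p 2 R 1)
          * (qUnit 2 R 1 * qUnit 2 R 1)
        = qUnit 2 R 1 * qUnit 2 R 1 * (qUnit 2 R 1 * ofWeyl 2 R (p 2 R 1))
          + 2 * (qUnit 2 R 1 * qUnit 2 R 1) := by
      generalize (qUnit 2 R 1 : WeylAlgebraLoc 2 R) * ofWeyl 2 R (p 2 R 1) = θ at h ⊢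
      rw [← mul_assoc, h, add_mul, mul_assoc, h]
      noncomm_ring
    rw [← mul_assoc, ← Algebra.commutes (↑t⁻¹ : R), mul_assoc, h', mul_add, two_mul, two_mul,
      mul_add, ← mul_assoc (algebraMap R _ _)]
  θ_mul_ζ :=
    have h := isWeylSystem_qUnit 2 R
    Commute.mul_left (Commute.mul_right (h.q_q 1 0) (Commute.symm (h.p_q 0 1 (by decide))))
      (Commute.mul_right (h.p_q 1 0 (by decide)) (h.p_p 1 0))

end Euler

end WeylAlgebraLoc

/-! ### The isomorphism of `𝒟′` with A'_2(k[z^{±1}][z']), and the center of `𝒟′`. -/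

namespace JordanDoubleLoc

open JordanDouble OreLocalization WeylAlgebraLoc

variable (k : Type*) [Field k]

/-- The generator `z` of the coefficient ring `k[z^{±1}][z']`. -/
noncomputable def zUnit : (LaurentPolynomial k)[X]ˣ where
  val := C (LaurentPolynomial.T 1)
  inv := C (LaurentPolynomial.T (-1))
  val_inv := by rw [← C_mul, ← LaurentPolynomial.T_add]; simp
  inv_val := by rw [← C_mul, ← LaurentPolynomial.T_add]; simp

theorem adjoin_laurent_eq_top : Algebra.adjoin k
    {(C (LaurentPolynomial.T 1) : (LaurentPolynomial k)[X]), C (LaurentPolynomial.T (-1)), X}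
      = ⊤ := by
  refine eq_top_iff.2 fun p _ => ?_
  set T := Algebra.adjoin k
    {(C (LaurentPolynomial.T 1) : (LaurentPolynomial k)[X]), C (LaurentPolynomial.T (-1)), X}
  have hT : (C (LaurentPolynomial.T 1) : (LaurentPolynomial k)[X]) ∈ T :=
    Algebra.subset_adjoin (by simp)
  have hT' : (C (LaurentPolynomial.T (-1)) : (LaurentPolynomial k)[X]) ∈ T :=
    Algebra.subset_adjoin (by simp)
  have hX : (X : (LaurentPolynomial k)[X]) ∈ T := Algebra.subset_adjoin (by simp)
  induction p using Polynomial.induction_on with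
  | C a =>
    induction a using LaurentPolynomial.induction_on with
    | h_C a => exact T.algebraMap_mem a
    | h_add ha hb => rw [C_add]; exact T.add_mem (ha trivial) (hb trivial)
    | h_C_mul_T n a h =>
      rw [LaurentPolynomial.T_add, ← mul_assoc, C_mul]
      exact T.mul_mem (h trivial) hT
    | h_C_mul_T_Z n a h =>
      rw [sub_eq_add_neg, LaurentPolynomial.T_add, ← mul_assoc, C_mul]
      exact T.mul_mem (h trivial) hT'
  | add p q hp hq => exact T.add_mem (hp trivial) (hq trivial)
  | monomial n a h =>
    rw [pow_succ, ← mul_assoc]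
    exact T.mul_mem (h trivial) hX

variable [CharZero k]

/-- The homomorphism `𝒟′ → A'_2(k[z^{±1}, z'])`. -/
noncomputable def toWeyl : JordanDoubleLoc k →ₐ[k] WeylAlgebraLoc 2 (LaurentPolynomial k)[X] :=
  liftAlgHom ((eulerSystem (zUnit k) X).hom k) fun s hs => isUnit_map_of_mem_closure _ (by
    rintro _ (rfl | rfl)
    · rw [EulerSystem.hom_gen]
      exact (qUnit 2 (LaurentPolynomial k)[X] 0).isUnit
    · rw [EulerSystem.hom_q]
      exact (qUnit 2 (LaurentPolynomial k)[X] 1).isUnit) hs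

theorem toWeyl_ofDAlgHom (a : JordanDouble k) :
    toWeyl k (ofDAlgHom k a) = (eulerSystem (zUnit k) X).hom k a :=
  liftAlgHom_numeratorAlgHom _ _ _

theorem toWeyl_z : toWeyl k (z k) = algebraMap (LaurentPolynomial k)[X] _ (C (LaurentPolynomial.T 1)) := by
  rw [z, ofD_apply, toWeyl_ofDAlgHom, JordanDouble.z, map_mul, map_pow, EulerSystem.hom_q,
    EulerSystem.hom_gen]
  change (qUnit 2 (LaurentPolynomial k)[X] 1 : WeylAlgebraLoc 2 (LaurentPolynomial k)[X]) ^ 2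
    * (algebraMap (LaurentPolynomial k)[X] _ ↑(zUnit k) * (↑(qUnit 2 (LaurentPolynomial k)[X] 1)⁻¹ * ↑(qUnit 2 (LaurentPolynomial k)[X] 1)⁻¹)) = _
  rw [(Algebra.commutes (zUnit k : (LaurentPolynomial k)[X]) _), pow_two, mul_assoc, mul_assoc,
    Units.mul_inv_cancel_left, Units.mul_inv_cancel_left]
  rfl

theorem toWeyl_q : toWeyl k (ofDAlgHom k (q k)) = qUnit 2 (LaurentPolynomial k)[X] 1 := by
  rw [toWeyl_ofDAlgHom, EulerSystem.hom_q]
  rfl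

theorem toWeyl_zPrime : toWeyl k (zPrime k) = algebraMap (LaurentPolynomial k)[X] _ X := by
  -- Apply the map to s = qz'; since s goes to qw, the unit q cancels.
  have h := congrArg (toWeyl k) (map_s k)
  rw [toWeyl_ofDAlgHom, EulerSystem.hom_s, map_mul, toWeyl_q] at h
  exact (Units.mul_right_inj _ |>.1 h).symm

theorem toWeyl_zInv : toWeyl k (zInv k) = algebraMap (LaurentPolynomial k)[X] _ (C (LaurentPolynomial.T (-1))) := by
  refine left_inv_eq_right_inv (a := toWeyl k (z k)) ?_ ?_
  · rw [← map_mul, zInv_mul_z, map_one]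
  · rw [toWeyl_z, ← map_mul]
    exact (congrArg (algebraMap (LaurentPolynomial k)[X] _) (zUnit k).mul_inv).trans (map_one _)

/-- `z` as a unit of the center of `𝒟′`. -/
noncomputable def zCenterUnit : (Subalgebra.center k (JordanDoubleLoc k))ˣ where
  val := ⟨z k, z_mem_center k⟩
  inv := ⟨zInv k, mem_center_of_commute_gen fun i =>
    have h : Commute (ofDAlgHom k (gen k i)) (z k) :=
      Subalgebra.mem_center_iff.1 (z_mem_center k) _
    (Commute.units_inv_right (u := ⟨z k, zInv k, z_mul_zInv k, zInv_mul_z k⟩) h).symm⟩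
  val_inv := Subtype.ext (z_mul_zInv k)
  inv_val := Subtype.ext (zInv_mul_z k)

/-- The homomorphism from `k[z^{±1}][z']` to the center of `𝒟′`. -/
noncomputable def centerHom :
    (LaurentPolynomial k)[X] →ₐ[k] Subalgebra.center k (JordanDoubleLoc k) :=
  { eval₂RingHom (LaurentPolynomial.eval₂ (algebraMap k _) (zCenterUnit k))
      ⟨zPrime k, zPrime_mem_center k⟩ with
    commutes' := fun c => by
      change eval₂ _ _ (C (LaurentPolynomial.C c)) = _
      rw [eval₂_C, LaurentPolynomial.eval₂_C] }

theorem centerHom_apply (r : (LaurentPolynomial k)[X]) : centerHom k r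
    = eval₂ (LaurentPolynomial.eval₂ (algebraMap k _) (zCenterUnit k))
      ⟨zPrime k, zPrime_mem_center k⟩ r := rfl

theorem centerHom_X : (centerHom k X : JordanDoubleLoc k) = zPrime k := by
  rw [centerHom_apply, eval₂_X]

theorem centerHom_zUnit : (centerHom k (zUnit k) : JordanDoubleLoc k) = z k := by
  simp [centerHom_apply, zUnit, zCenterUnit]

theorem centerHom_zUnit_inv : (centerHom k ↑(zUnit k)⁻¹ : JordanDoubleLoc k) = zInv k := by
  simp [centerHom_apply, zUnit, zCenterUnit, Units.inv_mk]

/-- The structure of a `k[z^{±1}][z']`-algebra on `𝒟′`. -/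
noncomputable abbrev algebraLaurent : Algebra (LaurentPolynomial k)[X] (JordanDoubleLoc k) :=
  ((Subalgebra.center k (JordanDoubleLoc k)).val.toRingHom.comp (centerHom k).toRingHom).toAlgebra'
    fun c a => (Subalgebra.mem_center_iff.1 (centerHom k c).2 a).symm

/-- The homomorphism `A'_2(k[z^{±1}, z']) → 𝒟′`. -/
noncomputable def ofWeylRingHom : WeylAlgebraLoc 2 (LaurentPolynomial k)[X] →+* JordanDoubleLoc k :=
  letI := algebraLaurent k
  (WeylAlgebraLoc.lift (coordinate k) (momentum k) (isWeylSystem k) (isUnit_coordinate k)).toRingHom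

theorem ofWeylRingHom_algebraMap (r : (LaurentPolynomial k)[X]) :
    ofWeylRingHom k (algebraMap (LaurentPolynomial k)[X] _ r) = centerHom k r :=
  letI := algebraLaurent k
  (WeylAlgebraLoc.lift (coordinate k) (momentum k) (isWeylSystem k)
    (isUnit_coordinate k)).commutes r

theorem ofWeylRingHom_q (i : Fin 2) : ofWeylRingHom k (qUnit 2 (LaurentPolynomial k)[X] i) = coordinate k i :=
  letI := algebraLaurent k
  WeylAlgebraLoc.lift_q (coordinate k) (momentum k) (isWeylSystem k) (isUnit_coordinate k) i

theorem ofWeylRingHom_p (i : Fin 2) :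
    ofWeylRingHom k (ofWeyl 2 (LaurentPolynomial k)[X] (WeylAlgebra.p 2 _ i)) = momentum k i :=
  letI := algebraLaurent k
  WeylAlgebraLoc.lift_p (coordinate k) (momentum k) (isWeylSystem k) (isUnit_coordinate k) i

/-- The homomorphism `A'_2(k[z^{±1}, z']) → 𝒟′` of `k`-algebras. -/
noncomputable def fromWeyl : WeylAlgebraLoc 2 (LaurentPolynomial k)[X] →ₐ[k] JordanDoubleLoc k :=
  { ofWeylRingHom k with
    commutes' := fun c => by
      have h := ofWeylRingHom_algebraMap k (algebraMap k _ c)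
      rw [AlgHom.commutes] at h
      exact h }

theorem fromWeyl_algebraMap (r : (LaurentPolynomial k)[X]) :
    fromWeyl k (algebraMap (LaurentPolynomial k)[X] _ r) = centerHom k r := ofWeylRingHom_algebraMap k r

theorem fromWeyl_q (i : Fin 2) : fromWeyl k (qUnit 2 (LaurentPolynomial k)[X] i) = coordinate k i := ofWeylRingHom_q k i

theorem fromWeyl_p (i : Fin 2) :
    fromWeyl k (ofWeyl 2 (LaurentPolynomial k)[X] (WeylAlgebra.p 2 _ i)) = momentum k i := ofWeylRingHom_p k i

theorem fromWeyl_q_zero_inv : fromWeyl k ↑(qUnit 2 (LaurentPolynomial k)[X] 0)⁻¹ = xInv k := by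
  refine left_inv_eq_right_inv (a := ofDAlgHom k (gen k .x)) ?_ (x_mul_xInv k)
  have h := congrArg (fromWeyl k) (qUnit 2 (LaurentPolynomial k)[X] 0).inv_mul
  rwa [map_mul, fromWeyl_q, map_one] at h

theorem fromWeyl_q_one_inv : fromWeyl k ↑(qUnit 2 (LaurentPolynomial k)[X] 1)⁻¹ = qInv k := by
  refine left_inv_eq_right_inv (a := ofDAlgHom k (q k)) ?_ (q_mul_qInv k)
  have h := congrArg (fromWeyl k) (qUnit 2 (LaurentPolynomial k)[X] 1).inv_mul
  rwa [map_mul, fromWeyl_q, map_one] at h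

/-- The Euler system in the Weyl algebra is carried to x, q, g, ζ, θ and z' in `𝒟′`, so the images
of u, y and v become the right-hand sides of `map_u`, `map_y` and `map_v`. -/
theorem fromWeyl_comp_hom : (fromWeyl k).comp ((eulerSystem (zUnit k) X).hom k) = ofDAlgHom k := by
  have hx : fromWeyl k (eulerSystem (zUnit k) X).x = ofDAlgHom k (gen k .x) := fromWeyl_q k 0
  have hxi : fromWeyl k (eulerSystem (zUnit k) X).xi = xInv k := fromWeyl_q_zero_inv k
  have hq : fromWeyl k (eulerSystem (zUnit k) X).q = ofDAlgHom k (q k) := fromWeyl_q k 1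
  have hw : fromWeyl k (eulerSystem (zUnit k) X).w = zPrime k :=
    (fromWeyl_algebraMap k X).trans (centerHom_X k)
  have hg : fromWeyl k (eulerSystem (zUnit k) X).g = ofDAlgHom k (gen k .g) := by
    rw [map_g, pow_two]
    simp only [eulerSystem, map_mul, fromWeyl_algebraMap, fromWeyl_q, centerHom_zUnit_inv]
    rfl
  have hgi : fromWeyl k (eulerSystem (zUnit k) X).gi = ofDAlgHom k (gen k .ginv) := by
    rw [map_ginv, pow_two]
    simp only [eulerSystem, map_mul, fromWeyl_algebraMap, fromWeyl_q_one_inv, centerHom_zUnit]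
  have hζ : fromWeyl k (eulerSystem (zUnit k) X).ζ = ofDAlgHom k (gen k .zeta) := by
    simp only [eulerSystem, map_mul, fromWeyl_q, fromWeyl_p]
    exact x_mul_xInv_mul k _
  have hθ : fromWeyl k (eulerSystem (zUnit k) X).θ = theta k := by
    simp only [eulerSystem, map_mul, fromWeyl_q, fromWeyl_p]
    exact q_mul_qInv_mul k _
  refine algHom_ext fun i => ?_
  rw [AlgHom.comp_apply, EulerSystem.hom_gen]
  cases i with
  | x => exact hx
  | g => exact hg
  | ginv => exact hgi
  | zeta => exact hζ
  | u =>
    rw [map_u]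
    simp only [EulerSystem.genImage, map_mul, map_sub, map_ofNat, hxi, hq, hg]
  | y =>
    rw [map_y]
    simp only [EulerSystem.genImage, map_mul, map_add, map_neg, map_smul, hx, hθ, hζ]
  | v =>
    rw [map_v]
    simp only [EulerSystem.genImage, map_mul, map_add, map_sub, map_smul, map_one, map_ofNat, hxi,
      hq, hg, hw, hθ, hζ]

theorem fromWeyl_toWeyl (a : JordanDoubleLoc k) : fromWeyl k (toWeyl k a) = a := by
  have h : ((fromWeyl k).comp (toWeyl k) : JordanDoubleLoc k →+* JordanDoubleLoc k)
      = RingHom.id _ := by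
    refine ringHom_ext_numerator (k := k) fun a => ?_
    change fromWeyl k (toWeyl k (ofDAlgHom k a)) = ofDAlgHom k a
    rw [toWeyl_ofDAlgHom]
    exact DFunLike.congr_fun (fromWeyl_comp_hom k) a
  exact DFunLike.congr_fun h a

/-- Both sides are homomorphisms of `k`-algebras in r, so comparison at z, z⁻¹ and z' is enough.
This is the statement that the isomorphism restricts to the identity on S. -/
theorem toWeyl_centerHom (r : (LaurentPolynomial k)[X]) :
    toWeyl k (centerHom k r) = algebraMap (LaurentPolynomial k)[X] _ r := by
  have h : ((toWeyl k).comp (Subalgebra.center k (JordanDoubleLoc k)).val).comp (centerHom k)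
      = scalars k 2 (LaurentPolynomial k)[X] := by
    refine AlgHom.ext_of_adjoin_eq_top (adjoin_laurent_eq_top k) ?_
    rintro _ (rfl | rfl | rfl)
    · exact (congrArg (toWeyl k) (centerHom_zUnit k)).trans (toWeyl_z k)
    · exact (congrArg (toWeyl k) (centerHom_zUnit_inv k)).trans (toWeyl_zInv k)
    · exact (congrArg (toWeyl k) (centerHom_X k)).trans (toWeyl_zPrime k)
  exact DFunLike.congr_fun h r

theorem toWeyl_fromWeyl (a : WeylAlgebraLoc 2 (LaurentPolynomial k)[X]) :
    toWeyl k (fromWeyl k a) = a := by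
  have hx : toWeyl k (ofDAlgHom k (gen k .x)) = qUnit 2 (LaurentPolynomial k)[X] 0 := by
    rw [toWeyl_ofDAlgHom, EulerSystem.hom_gen]
    rfl
  have hζ : toWeyl k (ofDAlgHom k (gen k .zeta))
      = qUnit 2 (LaurentPolynomial k)[X] 0 * ofWeyl 2 (LaurentPolynomial k)[X] (WeylAlgebra.p 2 _ 0) := by
    rw [toWeyl_ofDAlgHom, EulerSystem.hom_gen]
    rfl
  have hxi : toWeyl k (xInv k) = ↑(qUnit 2 (LaurentPolynomial k)[X] 0)⁻¹ := by
    refine left_inv_eq_right_inv (a := toWeyl k (ofDAlgHom k (gen k .x))) ?_ ?_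
    · rw [← map_mul, xInv_mul_x, map_one]
    · rw [hx, Units.mul_inv]
  have hy : toWeyl k (ofDAlgHom k (gen k .y)) = -((1 / 2 : k) • (qUnit 2 (LaurentPolynomial k)[X] 0
      * (qUnit 2 (LaurentPolynomial k)[X] 1 * ofWeyl 2 (LaurentPolynomial k)[X] (WeylAlgebra.p 2 _ 1)
        + qUnit 2 (LaurentPolynomial k)[X] 0 * ofWeyl 2 (LaurentPolynomial k)[X] (WeylAlgebra.p 2 _ 0)))) := by
    rw [toWeyl_ofDAlgHom, EulerSystem.hom_gen]
    rfl
  have hθ : toWeyl k (theta k) = qUnit 2 (LaurentPolynomial k)[X] 1 * ofWeyl 2 (LaurentPolynomial k)[X] (WeylAlgebra.p 2 _ 1) := by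
    rw [theta, map_sub, map_neg, map_smul, map_mul, hxi, hy, hζ, mul_neg, mul_smul_comm,
      Units.inv_mul_cancel_left]
    module
  have hqi : toWeyl k (qInv k) = ↑(qUnit 2 (LaurentPolynomial k)[X] 1)⁻¹ := by
    refine left_inv_eq_right_inv (a := toWeyl k (ofDAlgHom k (q k))) ?_ ?_
    · rw [← map_mul, qInv_mul_q, map_one]
    · rw [toWeyl_q, Units.mul_inv]
  have h : ((toWeyl k).comp (fromWeyl k) : WeylAlgebraLoc 2 (LaurentPolynomial k)[X] →+* _)
      = RingHom.id _ := by
    refine WeylAlgebraLoc.ringHom_ext (fun r => ?_) (fun i => ?_) (fun i => ?_)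
    · exact (congrArg (toWeyl k) (fromWeyl_algebraMap k r)).trans (toWeyl_centerHom k r)
    · change toWeyl k (fromWeyl k (qUnit 2 (LaurentPolynomial k)[X] i)) = qUnit 2 (LaurentPolynomial k)[X] i
      rw [fromWeyl_q]
      fin_cases i
      exacts [hx, toWeyl_q k]
    · change toWeyl k (fromWeyl k (ofWeyl 2 (LaurentPolynomial k)[X] (WeylAlgebra.p 2 _ i)))
        = ofWeyl 2 (LaurentPolynomial k)[X] (WeylAlgebra.p 2 _ i)
      rw [fromWeyl_p]
      fin_cases i
      · change toWeyl k (xInv k * ofDAlgHom k (gen k .zeta)) = _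
        rw [map_mul, hxi, hζ, Units.inv_mul_cancel_left]
        rfl
      · change toWeyl k (qInv k * theta k) = _
        rw [map_mul, hqi, hθ, Units.inv_mul_cancel_left]
        rfl
  exact DFunLike.congr_fun h a

/-- The isomorphism `𝒟′ ≃ A'_2(k[z^{±1}, z'])`. -/
noncomputable def equivWeyl : JordanDoubleLoc k ≃ₐ[k] WeylAlgebraLoc 2 (LaurentPolynomial k)[X] :=
  AlgEquiv.ofAlgHom (toWeyl k) (fromWeyl k) (AlgHom.ext (toWeyl_fromWeyl k))
    (AlgHom.ext (fromWeyl_toWeyl k))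

/-- Injectivity, that is, the algebraic independence of z and z', comes from the embedding of the
scalars into A'_2. Surjectivity carries a central element to A'_2, where it must be a scalar. -/
theorem centerHom_bijective : Function.Bijective (centerHom k) := by
  constructor
  · intro a b h
    apply WeylAlgebraLoc.algebraMap_injective 2
    rw [← toWeyl_centerHom, h, toWeyl_centerHom]
  · intro c
    have hc : toWeyl k c ∈ Subalgebra.center k (WeylAlgebraLoc 2 (LaurentPolynomial k)[X]) := by
      refine Subalgebra.mem_center_iff.2 fun m => ?_
      rw [← toWeyl_fromWeyl k m, ← map_mul, ← map_mul, Subalgebra.mem_center_iff.1 c.2]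
    rw [center_eq_range_scalars] at hc
    obtain ⟨r, hr⟩ := hc
    refine ⟨r, Subtype.ext ((equivWeyl k).injective ?_)⟩
    exact (toWeyl_centerHom k r).trans hr

/-- The center of `𝒟′` is the algebra `k[z^{±1}][z']`. -/
noncomputable def centerEquiv :
    (LaurentPolynomial k)[X] ≃ₐ[k] Subalgebra.center k (JordanDoubleLoc k) :=
  AlgEquiv.ofBijective (centerHom k) (centerHom_bijective k)

theorem adjoin_eq_center : Algebra.adjoin k {z k, zInv k, zPrime k}
    = Subalgebra.center k (JordanDoubleLoc k) := by
  have h : ((Subalgebra.center k (JordanDoubleLoc k)).val.comp (centerHom k)).range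
      = Subalgebra.center k (JordanDoubleLoc k) := by
    rw [AlgHom.range_comp, (AlgHom.range_eq_top _).2 (centerHom_bijective k).2, Algebra.map_top,
      Subalgebra.range_val]
  rw [← h, ← Algebra.map_top, ← adjoin_laurent_eq_top, AlgHom.map_adjoin]
  congr 1
  rw [Set.image_insert_eq, Set.image_pair]
  congr 1
  · exact (centerHom_zUnit k).symm
  · congr 1
    · exact (centerHom_zUnit_inv k).symm
    · exact congrArg _ (centerHom_X k).symm

end JordanDoubleLoc

theorem theorem4p7 (k : Type*) [Field k] [IsAlgClosed k] [CharZero k] :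
    -- `q` is normal in `𝒟`
    IsNormalElement (JordanDouble.q k) ∧
    -- `z` is invertible in `𝒟′`, and the two expressions of `z'` agree
    JordanDoubleLoc.z k * JordanDoubleLoc.zInv k = 1 ∧
    JordanDoubleLoc.zInv k * JordanDoubleLoc.z k = 1 ∧
    JordanDoubleLoc.zPrime k
      = JordanDoubleLoc.ofD k (JordanDouble.s k) * JordanDoubleLoc.qInv k ∧
    -- the center of `𝒟′` is the subalgebra generated by `z`, `z⁻¹`, `z'`
    Algebra.adjoin k {JordanDoubleLoc.z k, JordanDoubleLoc.zInv k, JordanDoubleLoc.zPrime k}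
      = Subalgebra.center k (JordanDoubleLoc k) ∧
    -- this center is `S = k[T^{±1}][X]` with `T = z` and `X = z'`, and `𝒟′ ≃ A'_2(S)` over `S`
    ∃ (φ : (LaurentPolynomial k)[X] ≃ₐ[k] Subalgebra.center k (JordanDoubleLoc k))
      (e : JordanDoubleLoc k ≃ₐ[k] WeylAlgebraLoc 2 (LaurentPolynomial k)[X]),
      (φ (C (LaurentPolynomial.T 1)) : JordanDoubleLoc k) = JordanDoubleLoc.z k ∧
      (φ X : JordanDoubleLoc k) = JordanDoubleLoc.zPrime k ∧
      ∀ a : (LaurentPolynomial k)[X],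
        e (φ a : JordanDoubleLoc k)
          = algebraMap (LaurentPolynomial k)[X]
              (WeylAlgebraLoc 2 (LaurentPolynomial k)[X]) a := by
  refine ⟨JordanDouble.isNormalElement_q, JordanDoubleLoc.z_mul_zInv k,
    JordanDoubleLoc.zInv_mul_z k, JordanDoubleLoc.zPrime_eq_s_mul_qInv k,
    JordanDoubleLoc.adjoin_eq_center k, JordanDoubleLoc.centerEquiv k, JordanDoubleLoc.equivWeyl k,
    JordanDoubleLoc.centerHom_zUnit k, JordanDoubleLoc.centerHom_X k,
    JordanDoubleLoc.toWeyl_centerHom k⟩
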